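/- For a polynomial $f\in\mathbb{Z}[x]$ let $H(f)$ denote its height, i.e. the largest absolute value of a coefficient of $f$, and for an integer $n\ge 1$ let $$B(n)=\max\{H(f) : f\in\mathbb{Z}[x],\ f\mid x^n-1\}.$$ Theorem. Let $p<q<r$ be odd primes with $q\equiv r \pmod p$ or $q\equiv -r\pmod p$, and let $0\le b\le 5$ be an integer. Then $B(pq^b)=B(pr^b)$. Consequently, for every odd prime $p$ and every integer $0\le b\le 5$, the value of $B(pq^b)$ at primes $q>p$ depends only on the residue class of $q$ modulo $p$ up to sign: there is a function $F:\mathbb{Z}/p\mathbb{Z}\to\mathbb{N}$ with $F(-a)=F(a)$ for all $a$, such that $B(pq^b)=F(q \bmod p)$ for all primes $q>p$. -/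

import Mathlib

open Polynomial

/-- The height of an integer polynomial: the largest absolute value of its coefficients
(and `0` for the zero polynomial). -/
def polyHeight (f : ℤ[X]) : ℕ :=
  f.support.sup fun i => (f.coeff i).natAbs

/-- The height agrees with the sup norm of a polynomial. -/
theorem polyHeight_eq_supNorm (f : ℤ[X]) : (polyHeight f : ℝ) = f.supNorm := by
  have hle : ∀ i, (f.coeff i).natAbs ≤ polyHeight f := by
    intro i
    by_cases hi : i ∈ f.support
    · exact Finset.le_sup (f := fun i => (f.coeff i).natAbs) hi
    · simp [notMem_support_iff.mp hi]
  have hnorm : ∀ i, ‖f.coeff i‖ = ((f.coeff i).natAbs : ℝ) := fun i => by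
    rw [Int.norm_eq_abs, Nat.cast_natAbs, Int.cast_abs]
  apply le_antisymm
  · by_cases hf : f = 0
    · simp [hf, polyHeight]
    · obtain ⟨i, -, hi⟩ := Finset.exists_mem_eq_sup f.support (nonempty_support_iff.mpr hf)
        fun i => (f.coeff i).natAbs
      have h := f.le_supNorm i
      rw [hnorm] at h
      exact (congrArg (Nat.cast : ℕ → ℝ) hi).trans_le h
  · obtain ⟨i, hi⟩ := f.exists_eq_supNorm
    rw [hi, hnorm]
    exact_mod_cast hle i

/-- `B(n)`: the largest height of a polynomial with integer coefficients dividing `x ^ n - 1`.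
For `n ≥ 1` the supremum is an attained maximum, see `isGreatest_maxDivisorHeight`. -/
noncomputable def maxDivisorHeight (n : ℕ) : ℕ :=
  sSup {h : ℕ | ∃ f : ℤ[X], f ∣ X ^ n - 1 ∧ polyHeight f = h}

theorem finite_divisors_X_pow_sub_one {n : ℕ} (hn : 0 < n) :
    {f : ℤ[X] | f ∣ X ^ n - 1}.Finite := by
  have hne : (X ^ n - 1 : ℤ[X]) ≠ 0 := (monic_X_pow_sub_C (1 : ℤ) hn.ne').ne_zero
  have hfin : Finite (ℤ[X])ˣ := by
    refine Finite.of_surjective (fun u : ℤˣ => Units.map (C : ℤ →+* ℤ[X]).toMonoidHom u) ?_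
    intro u
    obtain ⟨r, hr, hu⟩ := Polynomial.isUnit_iff.mp u.isUnit
    obtain ⟨v, rfl⟩ := hr
    exact ⟨v, Units.ext hu⟩
  have := Fintype.ofFinite (ℤ[X])ˣ
  exact Set.finite_coe_iff.mp
    (@Finite.of_fintype _ (UniqueFactorizationMonoid.fintypeSubtypeDvd (X ^ n - 1 : ℤ[X]) hne))

/-- For `n ≥ 1` the maximum in the definition of `B(n)` exists. -/
theorem isGreatest_maxDivisorHeight {n : ℕ} (hn : 0 < n) :
    IsGreatest {h : ℕ | ∃ f : ℤ[X], f ∣ X ^ n - 1 ∧ polyHeight f = h} (maxDivisorHeight n) := by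
  have hfin : {h : ℕ | ∃ f : ℤ[X], f ∣ X ^ n - 1 ∧ polyHeight f = h}.Finite :=
    (finite_divisors_X_pow_sub_one hn).image polyHeight
  exact ⟨Nat.sSup_mem ⟨_, 1, one_dvd _, rfl⟩ hfin.bddAbove, fun _ h => le_csSup hfin.bddAbove h⟩

/-!
Up to sign, a divisor of `X ^ (p * q ^ b) - 1` is a divisor `s` of `X ^ p - 1` times a product
`g₁(X) * g₂(X ^ q) * ⋯ * g_b(X ^ (q ^ (b - 1)))` with each `gᵢ` one of `1`, `Φ_q`, `Φ_q * Φ_(pq)`,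
`Φ_(pq)`: a word of length `b` in four letters (`exists_start_word_of_dvd`).

Heights are computed level by level. For `v` of degree less than `p`, the coefficients of
`v * g₁ * h(X ^ q)` at exponents congruent to `n` modulo `q` are those of `vₙ * h`, where `vₙ`
collects the coefficients of `v * g₁` along that class (`coeffBound_mul_expand`), and `vₙ` has again
degree less than `p`. If `v` has degree less than `p - 1` whenever `g₁ = Φ_(pq)`, then the
polynomials `vₙ` that occur depend only on `q` modulo `p`, and changing the sign of `q` at most
reflects and negates them (`exists_residuePart_eq`). Reflection is harmless, since the remaining factor is a palindrome.
Degree `p - 1` arises only from the letter `Φ_q * Φ_(pq)`, so for words in which this letter is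
never followed by `Φ_(pq)` the height depends only on `± q` modulo `p` (`coeffBound_transfer`);
the starting factors `Φ_p` and `X ^ p - 1` are reduced to `1` and `X - 1` by passing to a shorter word.

For the other words the height may vary, but it is too small to matter. Let `a` be the inverse
of `q` modulo `p` and `m = max a (p - a)`. Along each class, the coefficients of `Φ_(pq)` are `a`
ones or `p - a` minus ones (`isRun_residuePart_cyclotomic`), so a letter `Φ_(pq)` multiplies the
height by at most `m`; the other letters and the last letter cost nothing, and the starting factor
`X - 1` or `Φ_p` together with the first `Φ_(pq)` or `Φ_q` that meets it costs at most `p`. An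
exceptional word has a letter `Φ_q * Φ_(pq)`, so its height is at most `p * m ^ (b - 3)` with
truncated subtraction (see `TransferOrSmall`). For `2 ≤ b ≤ 5` some divisor, with starting
factor `Φ_p` and letters alternating between `Φ_q` and `Φ_(pq)`, has at least that height
(`exists_word_large`). From `b = 6` on the two bounds no longer meet.
-/

/-! ### Coefficient bounds and sums of absolute values -/

/-- All coefficients of `f` have absolute value at most `M`. -/
def CoeffBound (f : ℤ[X]) (M : ℤ) : Prop := ∀ i, |f.coeff i| ≤ M

theorem CoeffBound.mono {f : ℤ[X]} {M N : ℤ} (h : CoeffBound f M) (hMN : M ≤ N) :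
    CoeffBound f N := fun i => (h i).trans hMN

theorem CoeffBound.nonneg {f : ℤ[X]} {M : ℤ} (h : CoeffBound f M) : 0 ≤ M :=
  (abs_nonneg _).trans (h 0)

theorem CoeffBound.neg {f : ℤ[X]} {M : ℤ} (h : CoeffBound f M) : CoeffBound (-f) M := fun i => by
  simpa using h i

theorem coeffBound_iff_polyHeight {f : ℤ[X]} {M : ℕ} : CoeffBound f M ↔ polyHeight f ≤ M := by
  unfold CoeffBound polyHeight
  rw [Finset.sup_le_iff]
  constructor
  · intro h i _
    have := h i
    rw [Int.abs_eq_natAbs] at this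
    exact_mod_cast this
  · intro h i
    by_cases hi : i ∈ f.support
    · rw [Int.abs_eq_natAbs]
      exact_mod_cast h i hi
    · simp [notMem_support_iff.mp hi]

/-- The sum of the absolute values of the coefficients. -/
noncomputable def coeffSum (f : ℤ[X]) : ℤ := ∑ i ∈ f.support, |f.coeff i|

theorem coeffSum_eq_sum_range {f : ℤ[X]} {N : ℕ} (h : ∀ i, N ≤ i → f.coeff i = 0) :
    coeffSum f = ∑ i ∈ Finset.range N, |f.coeff i| := by
  unfold coeffSum
  refine Finset.sum_subset ?_ ?_
  · intro i hi
    rw [Finset.mem_range]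
    by_contra hc
    exact (mem_support_iff.mp hi) (h i (not_lt.mp hc))
  · intro i _ hi
    simp [notMem_support_iff.mp hi]

theorem coeffSum_neg (f : ℤ[X]) : coeffSum (-f) = coeffSum f := by
  simp [coeffSum]

theorem CoeffBound.mul {f h : ℤ[X]} {L M : ℤ} (hf : coeffSum f ≤ L) (hh : CoeffBound h M) :
    CoeffBound (f * h) (L * M) := by
  intro k
  have key : |(f * h).coeff k| ≤ coeffSum f * M := by
    conv_lhs => rw [f.as_sum_support]
    rw [Finset.sum_mul, finsetSum_coeff, coeffSum, Finset.sum_mul]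
    refine (Finset.abs_sum_le_sum_abs _ _).trans (Finset.sum_le_sum fun i _ => ?_)
    rw [← C_mul_X_pow_eq_monomial, mul_assoc, coeff_C_mul, coeff_X_pow_mul', mul_ite, mul_zero]
    split_ifs
    · rw [abs_mul]
      exact mul_le_mul_of_nonneg_left (hh _) (abs_nonneg _)
    · rw [abs_zero]
      exact mul_nonneg (abs_nonneg _) hh.nonneg
  exact key.trans (mul_le_mul_of_nonneg_right hf hh.nonneg)

/-- The coefficients of `f` are `0` or `1`. -/
def ZeroOne (f : ℤ[X]) : Prop := ∀ i, f.coeff i = 0 ∨ f.coeff i = 1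

theorem coeffSum_eq_eval_one {f : ℤ[X]} (h : ∀ i, 0 ≤ f.coeff i) : coeffSum f = f.eval 1 := by
  rw [eval_eq_sum, Polynomial.sum, coeffSum]
  exact Finset.sum_congr rfl fun i _ => by simp [abs_of_nonneg (h i)]

theorem ZeroOne.coeffSum {f : ℤ[X]} (h : ZeroOne f) : coeffSum f = f.eval 1 :=
  coeffSum_eq_eval_one fun i => by rcases h i with h | h <;> simp [h]

/-! ### Splitting coefficients by residue classes -/

/-- The polynomial whose coefficients are those of `f` at exponents `n, n + q, n + 2 * q, …`
(for `0 < q`, so that the truncation of the sum is immaterial). -/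
noncomputable def residuePart (q n : ℕ) (f : ℤ[X]) : ℤ[X] :=
  ∑ j ∈ Finset.range (f.natDegree + 1), monomial j (f.coeff (n + q * j))

theorem residuePart_coeff {q : ℕ} (hq : 0 < q) (n : ℕ) (f : ℤ[X]) (j : ℕ) :
    (residuePart q n f).coeff j = f.coeff (n + q * j) := by
  simp only [residuePart, finsetSum_coeff, coeff_monomial, Finset.sum_ite_eq', Finset.mem_range]
  split_ifs with h
  · rfl
  · refine (coeff_eq_zero_of_natDegree_lt ?_).symm
    have : j ≤ q * j := Nat.le_mul_of_pos_left j hq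
    omega

theorem coeff_mul_expand {q n : ℕ} (hn : n < q) (f h : ℤ[X]) (k : ℕ) :
    (f * expand ℤ q h).coeff (n + q * k) = (residuePart q n f * h).coeff k := by
  have hq : 0 < q := by omega
  induction h using Polynomial.induction_on' with
  | add a b ha hb => simp [mul_add, ha, hb]
  | monomial i a =>
    rw [expand_monomial, ← C_mul_X_pow_eq_monomial, ← C_mul_X_pow_eq_monomial, ← mul_assoc,
      ← mul_assoc, coeff_mul_X_pow', coeff_mul_X_pow', coeff_mul_C, coeff_mul_C]
    by_cases hik : i ≤ k
    · obtain ⟨c, rfl⟩ := Nat.exists_eq_add_of_le hik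
      have h1 : i * q ≤ n + q * (i + c) := by nlinarith
      have h2 : n + q * (i + c) - i * q = n + q * c := by
        rw [mul_add, mul_comm i q]; omega
      rw [if_pos h1, if_pos hik, h2, residuePart_coeff hq, Nat.add_sub_cancel_left]
    · have h1 : ¬ i * q ≤ n + q * k := by
        have : k + 1 ≤ i := by omega
        nlinarith
      rw [if_neg h1, if_neg hik]

theorem coeffBound_mul_expand {q : ℕ} (hq : 0 < q) (f h : ℤ[X]) (M : ℤ) :
    CoeffBound (f * expand ℤ q h) M ↔ ∀ n < q, CoeffBound (residuePart q n f * h) M := by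
  constructor
  · intro H n hn k
    rw [← coeff_mul_expand hn]
    exact H _
  · intro H i
    have := H (i % q) (Nat.mod_lt _ hq) (i / q)
    rwa [← coeff_mul_expand (Nat.mod_lt _ hq), Nat.mod_add_div] at this

theorem residuePart_eq_C {q n : ℕ} {f : ℤ[X]} (hf : ∀ i, q ≤ i → f.coeff i = 0) (hn : n < q) :
    residuePart q n f = C (f.coeff n) := by
  ext j
  rw [residuePart_coeff (by omega), coeff_C]
  split_ifs with h
  · simp [h]
  · have : q ≤ q * j := Nat.le_mul_of_pos_right q (Nat.pos_of_ne_zero h)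
    exact hf _ (by omega)

theorem coeffBound_mul_expand_of_lt {q : ℕ} (hq : 0 < q) {f : ℤ[X]}
    (hf : ∀ i, q ≤ i → f.coeff i = 0) (h : ℤ[X]) (M : ℤ) :
    CoeffBound (f * expand ℤ q h) M ↔ ∀ n < q, CoeffBound (C (f.coeff n) * h) M := by
  rw [coeffBound_mul_expand hq]
  refine forall₂_congr fun n hn => ?_
  rw [residuePart_eq_C hf hn]

theorem coeffBound_expand {q : ℕ} (hq : 0 < q) (h : ℤ[X]) (M : ℤ) :
    CoeffBound (expand ℤ q h) M ↔ CoeffBound h M := by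
  constructor
  · intro H i
    simpa [coeff_expand_mul' hq] using H (q * i)
  · intro H i
    rw [coeff_expand hq]
    split_ifs
    · exact H _
    · simpa using H.nonneg

theorem CoeffBound.C_mul {h : ℤ[X]} {M c : ℤ} (hh : CoeffBound h M) (hc : |c| ≤ 1) :
    CoeffBound (C c * h) M := fun i => by
  rw [coeff_C_mul, abs_mul]
  nlinarith [hh i, abs_nonneg c, abs_nonneg (h.coeff i)]

/-! ### Reflection -/

/-- `f` has degree at most `N` and is symmetric under `X ^ i ↔ X ^ (N - i)`. -/
def IsPalindrome (N : ℕ) (f : ℤ[X]) : Prop := f.natDegree ≤ N ∧ f.reflect N = f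

theorem IsPalindrome.mul {M N : ℕ} {f g : ℤ[X]} (hf : IsPalindrome M f) (hg : IsPalindrome N g) :
    IsPalindrome (M + N) (f * g) :=
  ⟨natDegree_mul_le.trans (add_le_add hf.1 hg.1), by
    rw [reflect_mul f g hf.1 hg.1, hf.2, hg.2]⟩

theorem coeff_reflect_of_le {N i : ℕ} (f : ℤ[X]) (hi : i ≤ N) :
    (f.reflect N).coeff i = f.coeff (N - i) := by
  rw [coeff_reflect, revAt_le hi]

theorem isPalindrome_iff {N : ℕ} {f : ℤ[X]} :
    IsPalindrome N f ↔ f.natDegree ≤ N ∧ ∀ i ≤ N, f.coeff (N - i) = f.coeff i := by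
  refine and_congr_right fun hN => ⟨fun h i hi => ?_, fun h => ?_⟩
  · rw [← coeff_reflect_of_le f hi, h]
  · ext i
    rcases le_or_gt i N with hi | hi
    · rw [coeff_reflect_of_le f hi, h i hi]
    · rw [coeff_reflect, revAt_eq_self_of_lt hi]

theorem IsPalindrome.expand {N : ℕ} {f : ℤ[X]} (hf : IsPalindrome N f) {q : ℕ} (hq : 0 < q) :
    IsPalindrome (N * q) (expand ℤ q f) := by
  rw [isPalindrome_iff] at hf ⊢
  refine ⟨by rw [natDegree_expand]; exact Nat.mul_le_mul_right q hf.1, fun i hi => ?_⟩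
  rw [coeff_expand hq, coeff_expand hq]
  by_cases hd : q ∣ i
  · obtain ⟨k, rfl⟩ := hd
    have hk : k ≤ N := by
      rw [mul_comm] at hi
      exact Nat.le_of_mul_le_mul_right hi hq
    have : N * q - q * k = q * (N - k) := by rw [Nat.mul_sub, mul_comm]
    rw [this, if_pos (dvd_mul_right _ _), if_pos (dvd_mul_right _ _),
      Nat.mul_div_cancel_left _ hq, Nat.mul_div_cancel_left _ hq, hf.2 k hk]
  · rw [if_neg hd, if_neg]
    intro h
    exact hd ((Nat.dvd_sub_iff_right hi (dvd_mul_left q N)).mp h)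

theorem CoeffBound.reflect {f : ℤ[X]} {M : ℤ} (h : CoeffBound f M) (N : ℕ) :
    CoeffBound (f.reflect N) M := fun i => by
  rw [coeff_reflect]
  exact h _

theorem CoeffBound.reflect_mul {f W : ℤ[X]} {M : ℤ} {N K : ℕ} (h : CoeffBound (f * W) M)
    (hf : f.natDegree ≤ N) (hW : IsPalindrome K W) : CoeffBound (f.reflect N * W) M := by
  have := h.reflect (N + K)
  rwa [Polynomial.reflect_mul f W hf hW.1, hW.2] at this

/-! ### The divisors of `X ^ (p * q ^ b) - 1` as words -/

/-- The four products of a subset of `{Φ_q, Φ_(pq)}`. -/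
inductive LevelFactor
  | none
  | phiQ
  | both
  | phiPQ

/-- The polynomial named by a `LevelFactor`. -/
noncomputable def LevelFactor.poly (p q : ℕ) : LevelFactor → ℤ[X]
  | none => 1
  | phiQ => cyclotomic q ℤ
  | both => cyclotomic q ℤ * cyclotomic (p * q) ℤ
  | phiPQ => cyclotomic (p * q) ℤ

/-- The product `g₁(X) * g₂(X ^ q) * g₃(X ^ (q ^ 2)) * ⋯` attached to a word `g₁ g₂ g₃ …`. -/
noncomputable def wordPoly (p q : ℕ) : List LevelFactor → ℤ[X]
  | [] => 1
  | g :: w => g.poly p q * expand ℤ q (wordPoly p q w)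

/-- The all-ones polynomial `1 + X + ⋯ + X ^ (p - 1)`. -/
noncomputable def ones (p : ℕ) : ℤ[X] := ∑ i ∈ Finset.range p, X ^ i

theorem coeff_ones (p i : ℕ) : (ones p).coeff i = if i < p then 1 else 0 := by
  simp [ones, finsetSum_coeff, coeff_X_pow]

theorem ones_mul (p : ℕ) : ones p * (X - 1) = X ^ p - 1 := geom_sum_mul X p

theorem cyclotomic_eq_ones {q : ℕ} (hq : q.Prime) : cyclotomic q ℤ = ones q := by
  have := Fact.mk hq
  exact cyclotomic_prime ℤ q

theorem isPalindrome_ones {p : ℕ} : IsPalindrome (p - 1) (ones p) := by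
  rw [isPalindrome_iff]
  refine ⟨?_, fun i hi => ?_⟩
  · rw [natDegree_le_iff_coeff_eq_zero]
    intro i hi
    rw [coeff_ones, if_neg (by omega)]
  · rw [coeff_ones, coeff_ones]
    congr 1
    apply propext
    omega

theorem expand_prime_ones {p q : ℕ} (hp : p.Prime) (hq : q.Prime) (hpq : p < q) :
    expand ℤ p (ones q) = ones q * cyclotomic (p * q) ℤ := by
  have hnd : ¬ p ∣ q := fun h => hpq.ne ((Nat.prime_dvd_prime_iff_eq hp hq).mp h)
  rw [← cyclotomic_eq_ones hq, cyclotomic_expand_eq_cyclotomic_mul hp hnd, mul_comm, mul_comm q]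

theorem expand_ones_prime {p q : ℕ} (hp : p.Prime) (hq : q.Prime) (hpq : p < q) :
    expand ℤ q (ones p) = ones p * cyclotomic (p * q) ℤ := by
  have hnd : ¬ q ∣ p := fun h => hpq.ne' ((Nat.prime_dvd_prime_iff_eq hq hp).mp h)
  rw [← cyclotomic_eq_ones hp, cyclotomic_expand_eq_cyclotomic_mul hq hnd, mul_comm]

theorem ones_ne_zero {p : ℕ} (hp : 0 < p) : ones p ≠ 0 := fun h => by
  have := coeff_ones p 0
  simp [h, hp] at this

theorem isPalindrome_cyclotomic_mul {p q : ℕ} (hp : p.Prime) (hq : q.Prime) (hpq : p < q) :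
    IsPalindrome ((p - 1) * (q - 1)) (cyclotomic (p * q) ℤ) := by
  have hcop : Nat.Coprime p q := (Nat.coprime_primes hp hq).mpr hpq.ne
  have hdeg : (cyclotomic (p * q) ℤ).natDegree ≤ (p - 1) * (q - 1) := by
    rw [natDegree_cyclotomic, Nat.totient_mul hcop, Nat.totient_prime hp, Nat.totient_prime hq]
  refine ⟨hdeg, ?_⟩
  -- `Φ_(pq)` is the quotient of two palindromes.
  have h1 := (isPalindrome_ones (p := p)).expand hq.pos
  have hN : (p - 1) * q = (p - 1) + (p - 1) * (q - 1) := by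
    obtain ⟨c, rfl⟩ := Nat.exists_eq_add_of_lt hq.pos
    simp; ring
  have h2 := reflect_mul (ones p) (cyclotomic (p * q) ℤ) (isPalindrome_ones (p := p)).1 hdeg
  rw [← expand_ones_prime hp hq hpq, ← hN, h1.2, (isPalindrome_ones (p := p)).2,
    expand_ones_prime hp hq hpq] at h2
  exact (mul_left_cancel₀ (ones_ne_zero hp.pos) h2).symm

theorem exists_isPalindrome_wordPoly {p q : ℕ} (hp : p.Prime) (hq : q.Prime) (hpq : p < q)
    (w : List LevelFactor) : ∃ K, IsPalindrome K (wordPoly p q w) := by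
  have h1 : IsPalindrome 0 (1 : ℤ[X]) := by simp [isPalindrome_iff]
  induction w with
  | nil => exact ⟨0, h1⟩
  | cons g w ih =>
    obtain ⟨K, hK⟩ := ih
    obtain ⟨N, hN⟩ : ∃ N, IsPalindrome N (g.poly p q) := by
      have hS : IsPalindrome (q - 1) (cyclotomic q ℤ) := by
        rw [cyclotomic_eq_ones hq]; exact isPalindrome_ones
      have hU := isPalindrome_cyclotomic_mul hp hq hpq
      cases g
      · exact ⟨0, h1⟩
      · exact ⟨_, hS⟩
      · exact ⟨_, hS.mul hU⟩
      · exact ⟨_, hU⟩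
    exact ⟨_, hN.mul (hK.expand hq.pos)⟩

theorem wordPoly_monic {p q : ℕ} (hq : q.Prime) (w : List LevelFactor) :
    (wordPoly p q w).Monic := by
  induction w with
  | nil => exact monic_one
  | cons g w ih =>
    refine Monic.mul ?_ (ih.expand hq.pos)
    cases g
    · exact monic_one
    · exact cyclotomic.monic _ _
    · exact (cyclotomic.monic _ _).mul (cyclotomic.monic _ _)
    · exact cyclotomic.monic _ _

theorem wordPoly_cons (p q : ℕ) (g : LevelFactor) (w : List LevelFactor) :
    wordPoly p q (g :: w) = g.poly p q * expand ℤ q (wordPoly p q w) := rfl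

/-! ### Coefficients of `v * g` along a residue class -/

theorem coeff_mul_ones {q : ℕ} {v : ℤ[X]} {p : ℕ} (hv : ∀ i, p ≤ i → v.coeff i = 0) (N : ℕ) :
    (v * ones q).coeff N =
      ∑ i ∈ Finset.range p, if i ≤ N ∧ N < i + q then v.coeff i else 0 := by
  have hv' : v = ∑ i ∈ Finset.range p, C (v.coeff i) * X ^ i := by
    ext k
    simp only [finsetSum_coeff, coeff_C_mul_X_pow, Finset.sum_ite_eq, Finset.mem_range]
    split_ifs with h
    · rfl
    · exact hv k (not_lt.mp h)
  conv_lhs => rw [hv']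
  rw [Finset.sum_mul, finsetSum_coeff]
  refine Finset.sum_congr rfl fun i _ => ?_
  rw [mul_assoc, coeff_C_mul, coeff_X_pow_mul', coeff_ones]
  by_cases h1 : i ≤ N
  · by_cases h2 : N < i + q
    · rw [if_pos h1, if_pos (by omega), if_pos ⟨h1, h2⟩, mul_one]
    · rw [if_pos h1, if_neg (by omega), if_neg (by tauto), mul_zero]
  · rw [if_neg h1, if_neg (by tauto), mul_zero]

theorem coeff_residuePart_mul_ones {p q n : ℕ} (hpq : p ≤ q) (hn : n < q) {v : ℤ[X]}
    (hv : ∀ i, p ≤ i → v.coeff i = 0) (j : ℕ) :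
    (residuePart q n (v * ones q)).coeff j =
      ∑ i ∈ Finset.range p, if (j = 0 ∧ i ≤ n) ∨ (j = 1 ∧ n < i) then v.coeff i else 0 := by
  rw [residuePart_coeff (by omega), coeff_mul_ones hv]
  refine Finset.sum_congr rfl fun i hi => ?_
  rw [Finset.mem_range] at hi
  congr 1
  apply propext
  rcases j with _ | _ | j
  · simp; omega
  · simp; omega
  · have : q * (j + 1 + 1) = q * j + 2 * q := by ring
    rw [this]
    simp
    intro _
    have : 0 ≤ q * j := Nat.zero_le _
    omega

theorem coeff_mul_expand_ones {p q : ℕ} (hp : 0 < p) {v : ℤ[X]}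
    (hv : ∀ i, p ≤ i → v.coeff i = 0) (N : ℕ) :
    (v * expand ℤ p (ones q)).coeff N = if N < p * q then v.coeff (N % p) else 0 := by
  have hm := Nat.mod_lt N hp
  conv_lhs => rw [← Nat.mod_add_div N p]
  rw [coeff_mul_expand hm, residuePart_eq_C hv hm, coeff_C_mul, coeff_ones, mul_ite, mul_one,
    mul_zero]
  congr 1
  exact propext (by rw [Nat.div_lt_iff_lt_mul hp, mul_comm])

theorem add_mul_lt_iff {p q n j : ℕ} (hn : n < q) : n + q * j < p * q ↔ j < p := by
  constructor
  · intro h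
    by_contra hc
    have : q * p ≤ q * j := Nat.mul_le_mul_left q (not_lt.mp hc)
    rw [mul_comm p] at h
    omega
  · intro h
    have : q * (j + 1) ≤ q * p := Nat.mul_le_mul_left q h
    rw [mul_comm p]
    rw [mul_add] at this
    omega

/-- The coefficient of `v` at the representative in `[0, p)` of a residue class. -/
noncomputable def cyclicCoeff {p : ℕ} (v : ℤ[X]) (x : ZMod p) : ℤ := v.coeff x.val

theorem cyclicCoeff_natCast {p : ℕ} (v : ℤ[X]) (N : ℕ) :
    cyclicCoeff v (N : ZMod p) = v.coeff (N % p) := by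
  rw [cyclicCoeff, ZMod.val_natCast]

theorem coeff_residuePart_mul_expand_ones {p q n : ℕ} (hp : 0 < p) (hn : n < q)
    {v : ℤ[X]} (hv : ∀ i, p ≤ i → v.coeff i = 0) (j : ℕ) :
    (residuePart q n (v * expand ℤ p (ones q))).coeff j =
      if j < p then cyclicCoeff v (n + q * j : ZMod p) else 0 := by
  rw [residuePart_coeff (by omega), coeff_mul_expand_ones hp hv]
  have : ((n : ZMod p) + q * j) = ((n + q * j : ℕ) : ZMod p) := by push_cast; rfl
  rw [this, cyclicCoeff_natCast]
  congr 1
  exact propext (add_mul_lt_iff hn)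

/-- Summing over a full period. -/
theorem sum_cyclicCoeff {p q : ℕ} [Fact p.Prime] (hq : (q : ZMod p) ≠ 0) (u : ℤ[X])
    (hu : ∀ i, p ≤ i → u.coeff i = 0) (x : ZMod p) :
    ∑ i ∈ Finset.range p, cyclicCoeff u (x + (q * i : ZMod p)) = u.eval 1 := by
  have hp : 0 < p := (Fact.out : p.Prime).pos
  have h1 : ∑ i ∈ Finset.range p, cyclicCoeff u (x + (q * i : ZMod p))
      = ∑ y : ZMod p, cyclicCoeff u y := by
    refine Finset.sum_bij' (fun i _ => x + q * (i : ZMod p))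
      (fun y _ => ((y - x) / q : ZMod p).val) (fun _ _ => Finset.mem_univ _) ?_ ?_ ?_ ?_
    · intro y _
      exact Finset.mem_range.mpr (ZMod.val_lt _)
    · intro i hi
      rw [Finset.mem_range] at hi
      simp only [add_sub_cancel_left, mul_div_cancel_left₀ _ hq]
      exact ZMod.val_cast_of_lt hi
    · intro y _
      simp only [ZMod.natCast_val, ZMod.cast_id', id_eq]
      field_simp
      ring
    · intro i _
      rfl
  have h2 : ∑ y : ZMod p, cyclicCoeff u y = ∑ i ∈ Finset.range p, u.coeff i := by
    refine Finset.sum_bij' (fun y _ => y.val) (fun i _ => (i : ZMod p))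
      (fun y _ => Finset.mem_range.mpr (ZMod.val_lt y)) (fun _ _ => Finset.mem_univ _) ?_ ?_ ?_
    · intro y _
      simp
    · intro i hi
      exact ZMod.val_cast_of_lt (Finset.mem_range.mp hi)
    · intro y _
      rfl
  rw [h1, h2, eval_eq_sum_range' (n := p + u.natDegree + 1) (by omega)]
  simp only [one_pow, mul_one]
  refine Finset.sum_subset (fun i hi => ?_) (fun i _ hi => ?_)
  · rw [Finset.mem_range] at *; omega
  · rw [Finset.mem_range] at hi
    exact hu i (by omega)

theorem coeff_mul_one_sub_X (v : ℤ[X]) (i : ℕ) :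
    (v * (1 - X)).coeff (i + 1) = v.coeff (i + 1) - v.coeff i := by
  rw [mul_sub, mul_one, coeff_sub, coeff_mul_X]

theorem mul_one_sub_X_coeff_eq_zero {v : ℤ[X]} {p : ℕ} (hv : ∀ i, p - 1 ≤ i → v.coeff i = 0)
    (i : ℕ) (hi : p ≤ i) : (v * (1 - X)).coeff i = 0 := by
  rcases i with _ | i
  · simp [hv 0 (by omega)]
  · rw [coeff_mul_one_sub_X, hv _ (by omega), hv _ (by omega), sub_zero]

/-- The relation `Φ_(pq) * (1 - X ^ q) = (1 - X) * Φ_q(X ^ p)` makes the coefficients of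
`v * Φ_(pq)` along a residue class modulo `q` the partial sums of a `p`-periodic sequence. -/
theorem coeff_residuePart_mul_cyclotomic {p q n : ℕ} (hp : p.Prime) (hq : q.Prime) (hpq : p < q)
    (hn : n < q) {v : ℤ[X]} (hv : ∀ i, p - 1 ≤ i → v.coeff i = 0) (j : ℕ) :
    (residuePart q n (v * cyclotomic (p * q) ℤ)).coeff j =
      if j < p then ∑ i ∈ Finset.range (j + 1), cyclicCoeff (v * (1 - X)) (n + q * i : ZMod p)
      else 0 := by
  have := Fact.mk hp
  set u := v * (1 - X) with hu
  have hu0 := mul_one_sub_X_coeff_eq_zero hv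
  set T := expand ℤ p (ones q) with hT
  have hrel : v * cyclotomic (p * q) ℤ - v * cyclotomic (p * q) ℤ * X ^ q = u * T := by
    rw [hT, expand_prime_ones hp hq hpq, hu]
    linear_combination (v * cyclotomic (p * q) ℤ) * ones_mul q
  have hT' : ∀ j, (u * T).coeff (n + q * j) =
      if j < p then cyclicCoeff u (n + q * j : ZMod p) else 0 := fun j => by
    rw [← coeff_residuePart_mul_expand_ones hp.pos hn hu0, residuePart_coeff hq.pos]
  have hsum : ∀ j, (v * cyclotomic (p * q) ℤ).coeff (n + q * j) =
      ∑ i ∈ Finset.range (j + 1),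
        if i < p then cyclicCoeff u (n + q * i : ZMod p) else 0 := by
    intro j
    induction j with
    | zero =>
      rw [zero_add, Finset.sum_range_one, ← hT', ← hrel, coeff_sub, coeff_mul_X_pow',
        if_neg (by omega), sub_zero]
    | succ j ih =>
      rw [Finset.sum_range_succ, ← ih, ← hT', ← hrel, coeff_sub, coeff_mul_X_pow',
        if_pos (by nlinarith)]
      have : n + q * (j + 1) - q = n + q * j := by rw [mul_add]; omega
      rw [this]; ring
  rw [residuePart_coeff hq.pos, hsum]
  split_ifs with h
  · refine Finset.sum_congr rfl fun i hi => ?_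
    rw [Finset.mem_range] at hi
    rw [if_pos (by omega)]
  · have hq0 : (q : ZMod p) ≠ 0 := by
      rw [Ne, ZMod.natCast_eq_zero_iff]
      exact fun h => hpq.ne ((Nat.prime_dvd_prime_iff_eq hp hq).mp h)
    rw [← Finset.sum_filter]
    have : (Finset.range (j + 1)).filter (· < p) = Finset.range p := by
      ext i; simp; omega
    rw [this, sum_cyclicCoeff hq0 u hu0, hu]
    simp

/-! ### Words whose height depends only on `± q` modulo `p` -/

/-- Somewhere in the word, `Φ_q * Φ_(pq)` at one level is followed by `Φ_(pq)` alone at the next.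
Only for these words can the height depend on more than the class of `± q` modulo `p`. -/
def BothThenPhiPQ : List LevelFactor → Prop
  | [] => False
  | g :: w => (g = .both ∧ w.head? = some .phiPQ) ∨ BothThenPhiPQ w

theorem natCast_ne_zero_of_primes {p q : ℕ} (hp : p.Prime) (hq : q.Prime) (hpq : p < q) :
    (q : ZMod p) ≠ 0 := by
  rw [Ne, ZMod.natCast_eq_zero_iff]
  exact fun h => hpq.ne ((Nat.prime_dvd_prime_iff_eq hp hq).mp h)

theorem both_poly {p q : ℕ} (hp : p.Prime) (hq : q.Prime) (hpq : p < q) :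
    LevelFactor.both.poly p q = expand ℤ p (ones q) := by
  rw [expand_prime_ones hp hq hpq, ← cyclotomic_eq_ones hq]; rfl

theorem phiQ_poly {p q : ℕ} (hq : q.Prime) : LevelFactor.phiQ.poly p q = ones q :=
  cyclotomic_eq_ones hq

theorem sum_cyclicCoeff_mul_one_sub_X {p q : ℕ} (hp : p.Prime) (hq : q.Prime) (hpq : p < q)
    {v : ℤ[X]} (hv : ∀ i, p - 1 ≤ i → v.coeff i = 0) (x : ZMod p) :
    ∑ i ∈ Finset.range p, cyclicCoeff (v * (1 - X)) (x + (q * i : ZMod p)) = 0 := by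
  have := Fact.mk hp
  rw [sum_cyclicCoeff (natCast_ne_zero_of_primes hp hq hpq) _ (mul_one_sub_X_coeff_eq_zero hv)]
  simp

theorem residuePart_mul_coeff_eq_zero {p q n : ℕ} (hp : p.Prime) (hp3 : 3 ≤ p) (hq : q.Prime)
    (hpq : p < q) (hn : n < q) {v : ℤ[X]} (hv : ∀ i, p ≤ i → v.coeff i = 0) {g : LevelFactor}
    (hvg : g = .phiPQ → ∀ i, p - 1 ≤ i → v.coeff i = 0) (i : ℕ) (hi : p ≤ i) :
    (residuePart q n (v * g.poly p q)).coeff i = 0 := by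
  cases g with
  | none =>
    rw [LevelFactor.poly, mul_one, residuePart_coeff hq.pos]
    have : q ≤ q * i := Nat.le_mul_of_pos_right q (by omega)
    exact hv _ (by omega)
  | phiQ =>
    rw [phiQ_poly hq, coeff_residuePart_mul_ones hpq.le hn hv]
    exact Finset.sum_eq_zero fun k _ => if_neg (by omega)
  | both =>
    rw [both_poly hp hq hpq, coeff_residuePart_mul_expand_ones hp.pos hn hv, if_neg (by omega)]
  | phiPQ =>
    rw [LevelFactor.poly, coeff_residuePart_mul_cyclotomic hp hq hpq hn (hvg rfl),
      if_neg (by omega)]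

theorem residuePart_mul_coeff_eq_zero_of_ne_both {p q n : ℕ} (hp : p.Prime) (hp3 : 3 ≤ p)
    (hq : q.Prime) (hpq : p < q) (hn : n < q) {v : ℤ[X]} (hv : ∀ i, p ≤ i → v.coeff i = 0)
    {g : LevelFactor} (hvg : g = .phiPQ → ∀ i, p - 1 ≤ i → v.coeff i = 0) (hg : g ≠ .both)
    (i : ℕ) (hi : p - 1 ≤ i) :
    (residuePart q n (v * g.poly p q)).coeff i = 0 := by
  cases g with
  | none =>
    rw [LevelFactor.poly, mul_one, residuePart_coeff hq.pos]
    have : q ≤ q * i := Nat.le_mul_of_pos_right q (by omega)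
    exact hv _ (by omega)
  | phiQ =>
    rw [phiQ_poly hq, coeff_residuePart_mul_ones hpq.le hn hv]
    exact Finset.sum_eq_zero fun k _ => if_neg (by omega)
  | both => exact absurd rfl hg
  | phiPQ =>
    rw [LevelFactor.poly, coeff_residuePart_mul_cyclotomic hp hq hpq hn (hvg rfl)]
    split_ifs with h
    · have : i + 1 = p := by omega
      rw [this]
      exact sum_cyclicCoeff_mul_one_sub_X hp hq hpq (hvg rfl) _
    · rfl

theorem natDegree_le_of_coeff {f : ℤ[X]} {N : ℕ} (h : ∀ i, N + 1 ≤ i → f.coeff i = 0) :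
    f.natDegree ≤ N :=
  natDegree_le_iff_coeff_eq_zero.mpr fun i hi => h i hi

/-- For primes `q ≡ ± r` modulo `p`, each residue part of `v * g` for `q` occurs for `r`, up to
sign and reflection. -/
theorem exists_residuePart_eq {p q r : ℕ} (hp : p.Prime) (hp3 : 3 ≤ p) (hq : q.Prime)
    (hr : r.Prime) (hpq : p < q) (hpr : p < r)
    (hqr : (q : ZMod p) = r ∨ (q : ZMod p) = -r) {v : ℤ[X]}
    (hv : ∀ i, p ≤ i → v.coeff i = 0) {g : LevelFactor}
    (hvg : g = .phiPQ → ∀ i, p - 1 ≤ i → v.coeff i = 0) {n : ℕ} (hn : n < q) :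
    ∃ n' < r, residuePart q n (v * g.poly p q) = residuePart r n' (v * g.poly p r) ∨
      ∃ N, (residuePart r n' (v * g.poly p r)).natDegree ≤ N ∧
        (residuePart q n (v * g.poly p q) = (residuePart r n' (v * g.poly p r)).reflect N ∨
        residuePart q n (v * g.poly p q) = -(residuePart r n' (v * g.poly p r)).reflect N) := by
  have := Fact.mk hp
  have hmod : ∀ N : ℕ, N % p < r := fun N => (Nat.mod_lt _ hp.pos).trans hpr
  have hcast : ∀ N : ℕ, ((N % p : ℕ) : ZMod p) = N := fun N => ZMod.natCast_mod N p
  -- When `q ≡ -r`, stepping backwards from the last class of the cycle matches the steps by `q`.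
  have hback : (q : ZMod p) = -r → ∀ i j : ℕ, i + j = p - 1 →
      ((n : ZMod p) + q * i) = (((n + q * (p - 1)) % p : ℕ) : ZMod p) + r * j := by
    intro h i j hij
    rw [hcast]
    push_cast
    rw [← hij]
    have hr' : (r : ZMod p) = -q := by rw [h, neg_neg]
    rw [hr']; push_cast; ring
  cases g with
  | none =>
    refine ⟨min n p, lt_of_le_of_lt (min_le_right _ _) hpr, Or.inl ?_⟩
    ext j
    simp only [LevelFactor.poly, mul_one, residuePart_coeff hq.pos, residuePart_coeff hr.pos]
    rcases Nat.eq_zero_or_pos j with rfl | hj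
    · rcases le_total n p with h | h
      · rw [min_eq_left h, mul_zero, mul_zero]
      · rw [min_eq_right h, hv _ (by omega), hv _ (by omega)]
    · have h1 : q ≤ q * j := Nat.le_mul_of_pos_right q hj
      have h2 : r ≤ r * j := Nat.le_mul_of_pos_right r hj
      rw [hv _ (by omega), hv _ (by omega)]
  | phiQ =>
    have hn' : min n (p - 1) < r := lt_of_le_of_lt (min_le_right _ _) (by omega)
    refine ⟨min n (p - 1), hn', Or.inl ?_⟩
    ext j
    rw [phiQ_poly hq, phiQ_poly hr, coeff_residuePart_mul_ones hpq.le hn hv,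
      coeff_residuePart_mul_ones hpr.le hn' hv]
    refine Finset.sum_congr rfl fun i hi => ?_
    rw [Finset.mem_range] at hi
    congr 1
    apply propext
    omega
  | both =>
    rw [both_poly hp hq hpq, both_poly hp hr hpr]
    rcases hqr with hqr | hqr
    · refine ⟨n % p, hmod n, Or.inl ?_⟩
      ext j
      rw [coeff_residuePart_mul_expand_ones hp.pos hn hv,
        coeff_residuePart_mul_expand_ones hp.pos (hmod n) hv, hcast, hqr]
    · refine ⟨(n + q * (p - 1)) % p, hmod _, Or.inr ⟨p - 1, ?_, Or.inl ?_⟩⟩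
      · refine natDegree_le_of_coeff fun i hi => ?_
        rw [coeff_residuePart_mul_expand_ones hp.pos (hmod _) hv, if_neg (by omega)]
      · ext j
        rw [coeff_residuePart_mul_expand_ones hp.pos hn hv]
        rcases le_or_gt j (p - 1) with hj | hj
        · rw [coeff_reflect_of_le _ hj, coeff_residuePart_mul_expand_ones hp.pos (hmod _) hv,
            if_pos (by omega), if_pos (by omega), hback hqr j (p - 1 - j) (by omega)]
        · rw [coeff_reflect, revAt_eq_self_of_lt hj,
            coeff_residuePart_mul_expand_ones hp.pos (hmod _) hv, if_neg (by omega),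
            if_neg (by omega)]
  | phiPQ =>
    have hv1 := hvg rfl
    simp only [LevelFactor.poly]
    rcases hqr with hqr | hqr
    · refine ⟨n % p, hmod n, Or.inl ?_⟩
      ext j
      rw [coeff_residuePart_mul_cyclotomic hp hq hpq hn hv1,
        coeff_residuePart_mul_cyclotomic hp hr hpr (hmod n) hv1, hcast, hqr]
    · have hlast : ∀ i, p - 1 ≤ i → (residuePart r ((n + q * (p - 1)) % p)
          (v * cyclotomic (p * r) ℤ)).coeff i = 0 := fun i hi =>
        residuePart_mul_coeff_eq_zero_of_ne_both (g := .phiPQ) hp hp3 hr hpr (hmod _) hv hvg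
          (by simp) i hi
      refine ⟨(n + q * (p - 1)) % p, hmod _, Or.inr ⟨p - 2, ?_, Or.inr ?_⟩⟩
      · exact natDegree_le_of_coeff fun i hi => hlast i (by omega)
      · ext j
        rw [coeff_neg]
        rcases le_or_gt j (p - 2) with hj | hj
        · rw [coeff_residuePart_mul_cyclotomic hp hq hpq hn hv1, coeff_reflect_of_le _ hj,
            coeff_residuePart_mul_cyclotomic hp hr hpr (hmod _) hv1,
            if_pos (by omega), if_pos (by omega)]
          -- The two partial sums are complementary in a full period, whose sum vanishes.
          have htot := sum_cyclicCoeff_mul_one_sub_X hp hq hpq hv1 (n : ZMod p)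
          rw [← Finset.sum_range_add_sum_Ico _ (show j + 1 ≤ p by omega)] at htot
          rw [eq_neg_iff_add_eq_zero, ← htot]
          congr 1
          refine Finset.sum_bij' (fun i _ => p - 1 - i) (fun i _ => p - 1 - i) ?_ ?_ ?_ ?_ ?_
          · intro i hi; simp only [Finset.mem_range, Finset.mem_Ico] at *; omega
          · intro i hi; simp only [Finset.mem_range, Finset.mem_Ico] at *; omega
          · intro i hi; simp only [Finset.mem_range] at *; omega
          · intro i hi; simp only [Finset.mem_Ico] at *; omega
          · intro i hi
            simp only [Finset.mem_range] at hi
            rw [hback hqr (p - 1 - i) i (by omega)]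
        · rw [coeff_reflect, revAt_eq_self_of_lt hj, hlast j (by omega), neg_zero]
          exact residuePart_mul_coeff_eq_zero_of_ne_both (g := .phiPQ) hp hp3 hq hpq hn hv hvg
            (by simp) j (by omega)

/-- The height of `v * wordPoly p q w` depends only on `± q` modulo `p` if `Φ_q * Φ_(pq)` is never
followed by `Φ_(pq)` in `w`. The degree bound on `v` is inherited by residue parts: only
`Φ_q * Φ_(pq)` produces degree `p - 1`, which is too large to be followed by `Φ_(pq)`. -/
theorem coeffBound_transfer {p q r : ℕ} (hp : p.Prime) (hp3 : 3 ≤ p) (hq : q.Prime)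
    (hr : r.Prime) (hpq : p < q) (hpr : p < r)
    (hqr : (q : ZMod p) = r ∨ (q : ZMod p) = -r) {M : ℤ} {w : List LevelFactor}
    (hw : ¬ BothThenPhiPQ w) {v : ℤ[X]} (hv : ∀ i, p ≤ i → v.coeff i = 0)
    (hvw : w.head? = some .phiPQ → ∀ i, p - 1 ≤ i → v.coeff i = 0)
    (h : CoeffBound (v * wordPoly p r w) M) : CoeffBound (v * wordPoly p q w) M := by
  induction w generalizing v with
  | nil => exact h
  | cons g w ih =>
    simp only [BothThenPhiPQ, not_or, not_and] at hw
    have hvg : g = .phiPQ → ∀ i, p - 1 ≤ i → v.coeff i = 0 := fun hg => hvw (by simp [hg])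
    rw [wordPoly_cons, ← mul_assoc, coeffBound_mul_expand (by omega)] at h ⊢
    intro n hn
    obtain ⟨n', hn', hsim⟩ := exists_residuePart_eq hp hp3 hq hr hpq hpr hqr hv hvg hn
    refine ih hw.2 (residuePart_mul_coeff_eq_zero hp hp3 hq hpq hn hv hvg) (fun hhead => ?_) ?_
    · exact residuePart_mul_coeff_eq_zero_of_ne_both hp hp3 hq hpq hn hv hvg
        fun hg => hw.1 hg hhead
    · obtain ⟨K, hK⟩ := exists_isPalindrome_wordPoly hp hr hpr w
      rcases hsim with hsim | ⟨N, hN, hsim | hsim⟩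
      · rw [hsim]; exact h n' hn'
      · rw [hsim]; exact (h n' hn').reflect_mul hN hK
      · rw [hsim, neg_mul]; exact ((h n' hn').reflect_mul hN hK).neg

/-! ### The residue parts of `Φ_(pq)` -/

/-- The inverse of `q` modulo `p`, as a number in `[0, p)`. -/
def inverseResidue (p q : ℕ) : ℕ := ((q : ZMod p)⁻¹).val

/-- The larger of `a` and `p - a`, where `a` is the inverse of `q` modulo `p`; it depends only on
the class of `± q`. -/
def inverseSpread (p q : ℕ) : ℕ := max (inverseResidue p q) (p - inverseResidue p q)

theorem inverseResidue_lt {p q : ℕ} (hp : p.Prime) : inverseResidue p q < p := by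
  have := Fact.mk hp
  exact ZMod.val_lt _

theorem inverseSpread_le {p q : ℕ} (hp : p.Prime) : inverseSpread p q ≤ p :=
  max_le (inverseResidue_lt hp).le (Nat.sub_le _ _)

theorem one_le_inverseSpread {p q : ℕ} (hp : p.Prime) : 1 ≤ inverseSpread p q := by
  have := inverseResidue_lt (q := q) hp
  unfold inverseSpread
  omega

theorem inverseSpread_eq {p q r : ℕ} (hp : p.Prime) (hq : q.Prime) (hpq : p < q)
    (hqr : (q : ZMod p) = r ∨ (q : ZMod p) = -r) : inverseSpread p q = inverseSpread p r := by
  have := Fact.mk hp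
  rcases hqr with h | h
  · simp only [inverseSpread, inverseResidue, h]
  · have hr : (r : ZMod p) = -q := by rw [h, neg_neg]
    have hne : ((q : ZMod p))⁻¹ ≠ 0 := inv_ne_zero (natCast_ne_zero_of_primes hp hq hpq)
    have hlt := ZMod.val_lt ((q : ZMod p))⁻¹
    simp only [inverseSpread, inverseResidue, hr, inv_neg, ZMod.neg_val, if_neg hne]
    omega

theorem eq_of_natCast_add_mul_eq {p q n i j : ℕ} (hp : p.Prime) (hq : (q : ZMod p) ≠ 0)
    (hi : i < p) (hj : j < p) (h : (n + q * i : ZMod p) = n + q * j) : i = j := by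
  have := Fact.mk hp
  have h1 : (i : ZMod p) = j := mul_left_cancel₀ hq (add_left_cancel h)
  rw [ZMod.natCast_eq_natCast_iff'] at h1
  rwa [Nat.mod_eq_of_lt hi, Nat.mod_eq_of_lt hj] at h1

theorem exists_natCast_add_mul_eq {p q : ℕ} (hp : p.Prime) (hq : (q : ZMod p) ≠ 0) (n : ℕ)
    (x : ZMod p) : ∃ i < p, (n + q * i : ZMod p) = x := by
  have := Fact.mk hp
  refine ⟨((x - n) / q : ZMod p).val, ZMod.val_lt _, ?_⟩
  simp only [ZMod.natCast_val, ZMod.cast_id', id_eq]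
  field_simp
  ring

theorem cyclicCoeff_sub {p : ℕ} (u v : ℤ[X]) (x : ZMod p) :
    cyclicCoeff (u - v) x = cyclicCoeff u x - cyclicCoeff v x := coeff_sub _ _ _

theorem cyclicCoeff_one {p : ℕ} (x : ZMod p) :
    cyclicCoeff 1 x = if x = 0 then 1 else 0 := by
  rw [cyclicCoeff, coeff_one]
  simp [ZMod.val_eq_zero]

theorem cyclicCoeff_X {p : ℕ} (hp : 1 < p) (x : ZMod p) :
    cyclicCoeff X x = if x = 1 then 1 else 0 := by
  have := Fact.mk hp
  rw [cyclicCoeff, coeff_X]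
  congr 1
  apply propext
  constructor
  · intro h
    apply ZMod.val_injective p
    rw [ZMod.val_one, h]
  · rintro rfl
    rw [ZMod.val_one]

/-- In each residue class modulo `q`, the coefficients of `Φ_(pq)` form a single run of equal
values: `1` on `[i₀, i₁)` or `-1` on `[i₁, i₀)`. -/
theorem coeff_residuePart_cyclotomic {p q n i₀ i₁ : ℕ} (hp : p.Prime) (hp3 : 3 ≤ p)
    (hq : q.Prime) (hpq : p < q) (hn : n < q) (h₀ : i₀ < p) (h₁ : i₁ < p)
    (e₀ : (n + q * i₀ : ZMod p) = 0) (e₁ : (n + q * i₁ : ZMod p) = 1) (j : ℕ) :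
    (residuePart q n (cyclotomic (p * q) ℤ)).coeff j =
      if j < p then (if i₀ ≤ j then 1 else 0) - (if i₁ ≤ j then 1 else 0) else 0 := by
  have hq0 := natCast_ne_zero_of_primes hp hq hpq
  have hv : ∀ i, p - 1 ≤ i → (1 : ℤ[X]).coeff i = 0 := fun i hi => by
    rw [coeff_one, if_neg (by omega)]
  have h := coeff_residuePart_mul_cyclotomic hp hq hpq hn hv j
  rw [one_mul] at h
  rw [h]
  split_ifs with hj
  all_goals try rfl
  all_goals
    have hc : ∀ i ∈ Finset.range (j + 1), cyclicCoeff (1 * (1 - X)) (n + q * i : ZMod p) =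
        (if i = i₀ then 1 else 0) - (if i = i₁ then 1 else 0) := by
      intro i hi
      rw [Finset.mem_range] at hi
      rw [one_mul, cyclicCoeff_sub, cyclicCoeff_one, cyclicCoeff_X hp.one_lt]
      congr 2
      · refine propext ⟨fun h => ?_, fun h => by rw [h, e₀]⟩
        exact eq_of_natCast_add_mul_eq hp hq0 (by omega) h₀ (h.trans e₀.symm)
      · refine propext ⟨fun h => ?_, fun h => by rw [h, e₁]⟩
        exact eq_of_natCast_add_mul_eq hp hq0 (by omega) h₁ (h.trans e₁.symm)
    rw [Finset.sum_congr rfl hc, Finset.sum_sub_distrib, Finset.sum_ite_eq', Finset.sum_ite_eq']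
    simp only [Finset.mem_range]
    grind

theorem eval_one_eq_sum_range {f : ℤ[X]} {N : ℕ} (h : ∀ i, N ≤ i → f.coeff i = 0) :
    f.eval 1 = ∑ i ∈ Finset.range N, f.coeff i := by
  rw [eval_eq_sum_range' (n := N + f.natDegree + 1) (by omega)]
  simp only [one_pow, mul_one]
  refine (Finset.sum_subset (fun i hi => ?_) (fun i _ hi => ?_)).symm
  · rw [Finset.mem_range] at *; omega
  · rw [Finset.mem_range] at hi
    exact h i (by omega)

theorem sum_range_indicator_le {p i : ℕ} (hi : i < p) :
    ∑ j ∈ Finset.range p, (if i ≤ j then (1 : ℤ) else 0) = p - i := by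
  rw [← Finset.sum_range_add_sum_Ico _ hi.le]
  rw [Finset.sum_eq_zero fun j hj => if_neg (by rw [Finset.mem_range] at hj; omega),
    Finset.sum_congr rfl fun j hj => if_pos (Finset.mem_Ico.mp hj).1]
  simp
  omega

/-- The possible shapes of a residue part of `Φ_(pq)`: `a` coefficients equal to `1`, or `p - a`
coefficients equal to `-1`, the others being `0`. -/
def IsRun (p a : ℕ) (f : ℤ[X]) : Prop :=
  (∀ i, p ≤ i → f.coeff i = 0) ∧
    ((ZeroOne f ∧ f.eval 1 = a) ∨ (ZeroOne (-f) ∧ f.eval 1 = a - p))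

theorem eval_one_residuePart_cyclotomic {p q n i₀ i₁ : ℕ} (hp : p.Prime) (hp3 : 3 ≤ p)
    (hq : q.Prime) (hpq : p < q) (hn : n < q) (h₀ : i₀ < p) (h₁ : i₁ < p)
    (e₀ : (n + q * i₀ : ZMod p) = 0) (e₁ : (n + q * i₁ : ZMod p) = 1) :
    (residuePart q n (cyclotomic (p * q) ℤ)).eval 1 = i₁ - i₀ := by
  have hc := coeff_residuePart_cyclotomic hp hp3 hq hpq hn h₀ h₁ e₀ e₁
  rw [eval_one_eq_sum_range (N := p) fun i hi => by rw [hc, if_neg (by omega)]]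
  rw [Finset.sum_congr rfl fun j hj => by rw [hc, if_pos (Finset.mem_range.mp hj)],
    Finset.sum_sub_distrib, sum_range_indicator_le h₀, sum_range_indicator_le h₁]
  ring

theorem isRun_residuePart_cyclotomic {p q n : ℕ} (hp : p.Prime) (hp3 : 3 ≤ p)
    (hq : q.Prime) (hpq : p < q) (hn : n < q) :
    IsRun p (inverseResidue p q) (residuePart q n (cyclotomic (p * q) ℤ)) := by
  have := Fact.mk hp
  have hq0 := natCast_ne_zero_of_primes hp hq hpq
  obtain ⟨i₀, h₀, e₀⟩ := exists_natCast_add_mul_eq hp hq0 n 0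
  obtain ⟨i₁, h₁, e₁⟩ := exists_natCast_add_mul_eq hp hq0 n 1
  have hc := coeff_residuePart_cyclotomic hp hp3 hq hpq hn h₀ h₁ e₀ e₁
  have he := eval_one_residuePart_cyclotomic hp hp3 hq hpq hn h₀ h₁ e₀ e₁
  refine ⟨fun i hi => by rw [hc, if_neg (by omega)], ?_⟩
  have hinv : (q : ZMod p)⁻¹ = i₁ - i₀ := by
    field_simp
    linear_combination e₀ - e₁
  rcases le_or_gt i₀ i₁ with h | h
  · left
    refine ⟨fun j => ?_, ?_⟩
    · rw [hc]; split_ifs <;> omega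
    · have : inverseResidue p q = i₁ - i₀ := by
        rw [inverseResidue, hinv, ← Nat.cast_sub h, ZMod.val_cast_of_lt (by omega)]
      rw [he, this, Nat.cast_sub h]
  · right
    refine ⟨fun j => ?_, ?_⟩
    · rw [coeff_neg, hc]; split_ifs <;> omega
    · have : inverseResidue p q = p - (i₀ - i₁) := by
        have h2 : ((p - (i₀ - i₁) : ℕ) : ZMod p) = i₁ - i₀ := by
          rw [Nat.cast_sub (by omega), Nat.cast_sub h.le, ZMod.natCast_self]; ring
        rw [inverseResidue, hinv, ← h2, ZMod.val_cast_of_lt (by omega)]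
      rw [he, this]
      omega

theorem IsRun.abs_coeff_le {p a : ℕ} {f : ℤ[X]} (h : IsRun p a f) : CoeffBound f 1 := fun i => by
  rcases h.2 with h | h
  · rcases h.1 i with h | h <;> simp [h]
  · have := h.1 i
    rw [coeff_neg] at this
    rw [abs_le]
    omega

theorem IsRun.coeffSum_le {p a : ℕ} {f : ℤ[X]} (h : IsRun p a f) (ha : a < p) :
    coeffSum f ≤ (max a (p - a) : ℕ) := by
  rcases h.2 with h | h
  · rw [h.1.coeffSum, h.2]
    omega
  · rw [← coeffSum_neg, h.1.coeffSum, eval_neg, h.2]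
    omega

/-- Two runs of the same sign have a difference with coefficients at most `1`; for runs of opposite
signs the lengths `a` and `p - a` add up to `p`. -/
theorem IsRun.coeffSum_sub_le {p a : ℕ} {f g : ℤ[X]} (hf : IsRun p a f) (hg : IsRun p a g) :
    coeffSum (f - g) ≤ p := by
  have hzero : ∀ i, p ≤ i → (f - g).coeff i = 0 := fun i hi => by
    rw [coeff_sub, hf.1 i hi, hg.1 i hi, sub_zero]
  have hsame : (∀ i, |(f - g).coeff i| ≤ 1) → coeffSum (f - g) ≤ p := fun h => by
    rw [coeffSum_eq_sum_range hzero]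
    refine (Finset.sum_le_sum fun i _ => h i).trans ?_
    simp
  rcases hf.2 with hf' | hf' <;> rcases hg.2 with hg' | hg'
  · refine hsame fun i => ?_
    have h1 := hf'.1 i
    have h2 := hg'.1 i
    rw [coeff_sub, abs_le]
    omega
  · rw [coeffSum_eq_eval_one, eval_sub, hf'.2, hg'.2]
    · omega
    · intro i
      have h1 := hf'.1 i
      have h2 := hg'.1 i
      rw [coeff_neg] at h2
      rw [coeff_sub]
      omega
  · rw [← coeffSum_neg, coeffSum_eq_eval_one, eval_neg, eval_sub, hf'.2, hg'.2]
    · omega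
    · intro i
      have h1 := hf'.1 i
      have h2 := hg'.1 i
      rw [coeff_neg] at h1
      rw [coeff_neg, coeff_sub]
      omega
  · refine hsame fun i => ?_
    have h1 := hf'.1 i
    have h2 := hg'.1 i
    rw [coeff_neg] at h1 h2
    rw [coeff_sub, abs_le]
    omega

theorem residuePart_X_pow_mul {q n i : ℕ} (hn : n < q) (hi : i < q) (f : ℤ[X]) :
    ∃ n' < q, residuePart q n (X ^ i * f) = residuePart q n' f ∨
      residuePart q n (X ^ i * f) = X * residuePart q n' f := by
  have hq : 0 < q := by omega
  rcases le_or_gt i n with h | h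
  · refine ⟨n - i, by omega, Or.inl ?_⟩
    ext j
    rw [residuePart_coeff hq, residuePart_coeff hq, coeff_X_pow_mul', if_pos (by omega)]
    congr 1
    omega
  · refine ⟨n + q - i, by omega, Or.inr ?_⟩
    ext j
    rw [residuePart_coeff hq, coeff_X_pow_mul']
    rcases j with _ | j
    · rw [if_neg (by omega), mul_comm, mul_coeff_zero, coeff_X_zero, mul_zero]
    · rw [mul_comm X, coeff_mul_X, residuePart_coeff hq]
      have : q * (j + 1) = q * j + q := by ring
      rw [if_pos (by omega)]
      congr 1
      omega

theorem residuePart_sub {q : ℕ} (hq : 0 < q) (n : ℕ) (f g : ℤ[X]) :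
    residuePart q n (f - g) = residuePart q n f - residuePart q n g := by
  ext j
  simp [residuePart_coeff hq]

theorem isRun_residuePart_X_pow_mul {p q n i : ℕ} (hp : p.Prime) (hp3 : 3 ≤ p) (hq : q.Prime)
    (hpq : p < q) (hn : n < q) (hi : i < q) :
    IsRun p (inverseResidue p q) (residuePart q n (X ^ i * cyclotomic (p * q) ℤ)) := by
  obtain ⟨n', hn', h | h⟩ := residuePart_X_pow_mul hn hi (cyclotomic (p * q) ℤ)
  · rw [h]; exact isRun_residuePart_cyclotomic hp hp3 hq hpq hn'
  · rw [h]
    have hrun := isRun_residuePart_cyclotomic hp hp3 hq hpq hn'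
    have hlast := residuePart_mul_coeff_eq_zero_of_ne_both (g := .phiPQ) (v := 1) hp hp3 hq hpq hn'
      (fun i hi => by rw [coeff_one, if_neg (by omega)])
      (fun _ i hi => by rw [coeff_one, if_neg (by omega)]) (by simp)
    simp only [LevelFactor.poly, one_mul] at hlast
    have hzo : ∀ f : ℤ[X], ZeroOne f → ZeroOne (X * f) := fun f hf i => by
      rcases i with _ | i
      · simp
      · rw [mul_comm, coeff_mul_X]; exact hf i
    refine ⟨fun i hi => ?_, ?_⟩
    · obtain ⟨i, rfl⟩ : ∃ k, i = k + 1 := ⟨i - 1, by omega⟩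
      rw [mul_comm, coeff_mul_X]
      exact hlast i (by omega)
    · rw [eval_mul, eval_X, one_mul, ← mul_neg]
      exact hrun.2.imp (And.imp_left (hzo _)) (And.imp_left (hzo _))

/-! ### Upper bounds for heights -/

theorem coeffBound_cons {p q : ℕ} (hq : 0 < q) {v : ℤ[X]} {g : LevelFactor}
    {w : List LevelFactor} {L M : ℤ}
    (hL : ∀ n < q, coeffSum (residuePart q n (v * g.poly p q)) ≤ L)
    (hw : CoeffBound (wordPoly p q w) M) : CoeffBound (v * wordPoly p q (g :: w)) (L * M) := by
  rw [wordPoly_cons, ← mul_assoc, coeffBound_mul_expand hq]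
  exact fun n hn => hw.mul (hL n hn)

/-- A factor of degree less than `q` with coefficients in `{-1, 0, 1}` does not affect the height
of a polynomial in `X ^ q`. -/
theorem coeffBound_mul_expand_iff {q : ℕ} (hq : 0 < q) {f : ℤ[X]}
    (hf : ∀ i, q ≤ i → f.coeff i = 0) (hf1 : CoeffBound f 1) (hf0 : |f.coeff 0| = 1)
    (h : ℤ[X]) (M : ℤ) : CoeffBound (f * expand ℤ q h) M ↔ CoeffBound h M := by
  rw [coeffBound_mul_expand_of_lt hq hf]
  constructor
  · intro H i
    have := H 0 hq i
    rwa [coeff_C_mul, abs_mul, hf0, one_mul] at this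
  · exact fun H n _ => H.C_mul (hf1 n)

theorem coeffBound_ones (p : ℕ) : CoeffBound (ones p) 1 := fun i => by
  rw [coeff_ones]; split_ifs <;> simp

theorem coeffBound_X_pow_sub_one (p : ℕ) : CoeffBound (X ^ p - 1) 1 := fun i => by
  rw [coeff_sub, coeff_X_pow, coeff_one]
  split_ifs <;> simp

theorem X_pow_sub_one_coeff_eq_zero {p : ℕ} (i : ℕ) (hi : p < i) :
    (X ^ p - 1 : ℤ[X]).coeff i = 0 := by
  rw [coeff_sub, coeff_X_pow, coeff_one, if_neg (by omega), if_neg (by omega), sub_zero]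

theorem abs_X_pow_sub_one_coeff_zero {p : ℕ} (hp : 0 < p) :
    |(X ^ p - 1 : ℤ[X]).coeff 0| = 1 := by
  rw [coeff_sub, coeff_X_pow, coeff_one, if_neg (by omega)]
  simp

theorem coeffBound_wordPoly_cons {p q : ℕ} (hp : p.Prime) (hq : q.Prime) (hpq : p < q)
    {g : LevelFactor} (hg : g ≠ .phiPQ) {w : List LevelFactor} {M : ℤ}
    (hw : CoeffBound (wordPoly p q w) M) : CoeffBound (wordPoly p q (g :: w)) M := by
  have := Fact.mk hp
  cases g with
  | none => simpa [wordPoly_cons, LevelFactor.poly, coeffBound_expand hq.pos] using hw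
  | phiQ =>
    rw [wordPoly_cons, phiQ_poly hq, coeffBound_mul_expand_iff hq.pos _ (coeffBound_ones q)]
    · exact hw
    · simp [coeff_ones, hq.pos]
    · intro i hi
      rw [coeff_ones, if_neg (by omega)]
  | both =>
    have hv : ∀ i, p ≤ i → (1 : ℤ[X]).coeff i = 0 := fun i hi => by
      rw [coeff_one, if_neg (by have := hp.pos; omega)]
    have := coeffBound_cons (p := p) (v := 1) (g := .both) (L := 1) hq.pos (fun n hn => ?_) hw
    · rwa [one_mul, one_mul] at this
    · have hc := coeff_residuePart_mul_expand_ones hp.pos hn hv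
      rw [both_poly hp hq hpq, coeffSum_eq_sum_range (N := p) fun i hi => by
        rw [hc, if_neg (by omega)]]
      have hs := sum_cyclicCoeff (natCast_ne_zero_of_primes hp hq hpq) 1 hv (n : ZMod p)
      rw [eval_one] at hs
      rw [← hs]
      refine le_of_eq (Finset.sum_congr rfl fun i hi => ?_)
      rw [hc, if_pos (Finset.mem_range.mp hi), abs_of_nonneg]
      rw [cyclicCoeff_one]
      split_ifs <;> simp
  | phiPQ => exact absurd rfl hg

theorem coeffBound_wordPoly_phiPQ {p q : ℕ} (hp : p.Prime) (hp3 : 3 ≤ p) (hq : q.Prime)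
    (hpq : p < q) {w : List LevelFactor} {M : ℤ} (hw : CoeffBound (wordPoly p q w) M) :
    CoeffBound (wordPoly p q (.phiPQ :: w)) (inverseSpread p q * M) := by
  have := coeffBound_cons (p := p) (v := 1) (g := .phiPQ) (L := inverseSpread p q) hq.pos
    (fun n hn => ?_) hw
  · rwa [one_mul] at this
  · rw [one_mul]
    exact (isRun_residuePart_cyclotomic hp hp3 hq hpq hn).coeffSum_le (inverseResidue_lt hp)

theorem coeffBound_one : CoeffBound 1 1 := fun i => by
  rw [coeff_one]; split_ifs <;> simp

theorem coeffBound_wordPoly {p q : ℕ} (hp : p.Prime) (hp3 : 3 ≤ p) (hq : q.Prime)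
    (hpq : p < q) (w : List LevelFactor) :
    CoeffBound (wordPoly p q w) ((inverseSpread p q : ℤ) ^ (w.length - 1)) := by
  have hm : (1 : ℤ) ≤ inverseSpread p q := by exact_mod_cast one_le_inverseSpread hp
  induction w with
  | nil => exact coeffBound_one
  | cons g w ih =>
    by_cases hg : g = .phiPQ
    · subst hg
      rcases w with _ | ⟨g', w⟩
      · simp only [wordPoly, map_one, LevelFactor.poly]
        rw [← map_one (expand ℤ q), coeffBound_mul_expand hq.pos]
        intro n hn
        rw [mul_one]
        simpa using (isRun_residuePart_cyclotomic hp hp3 hq hpq hn).abs_coeff_le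
      · have := coeffBound_wordPoly_phiPQ hp hp3 hq hpq ih
        rw [← pow_succ'] at this
        simpa using this
    · exact (coeffBound_wordPoly_cons hp hq hpq hg ih).mono
        (pow_le_pow_right₀ hm (by simp))

theorem BothThenPhiPQ.two_le_length {w : List LevelFactor} (h : BothThenPhiPQ w) :
    2 ≤ w.length := by
  induction w with
  | nil => exact h.elim
  | cons g w ih =>
    rcases h with h | h
    · rcases w with _ | ⟨g', w⟩
      · simp at h
      · simp
    · have := ih h
      simp; omega

/-- The level at which `Φ_q * Φ_(pq)` occurs contributes nothing to the height, which saves a factor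
over the general bound `coeffBound_wordPoly`. -/
theorem BothThenPhiPQ.coeffBound_wordPoly {p q : ℕ} (hp : p.Prime) (hp3 : 3 ≤ p) (hq : q.Prime)
    (hpq : p < q) {w : List LevelFactor} (hw : BothThenPhiPQ w) :
    CoeffBound (wordPoly p q w) ((inverseSpread p q : ℤ) ^ (w.length - 2)) := by
  have hm : (1 : ℤ) ≤ inverseSpread p q := by exact_mod_cast one_le_inverseSpread hp
  induction w with
  | nil => exact hw.elim
  | cons g w ih =>
    by_cases hg : g = .phiPQ
    · have hw' : BothThenPhiPQ w := by
        rcases hw with hw | hw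
        · simp [hg] at hw
        · exact hw
      have hlen := hw'.two_le_length
      have := coeffBound_wordPoly_phiPQ hp hp3 hq hpq (ih hw')
      rw [← pow_succ'] at this
      rw [hg, List.length_cons, show w.length + 1 - 2 = w.length - 2 + 1 by omega]
      exact this
    · have := coeffBound_wordPoly_cons hp hq hpq hg (_root_.coeffBound_wordPoly hp hp3 hq hpq w)
      rwa [List.length_cons, show w.length + 1 - 2 = w.length - 1 by omega]

theorem coeffBound_X_pow_sub_X_pow_mul {p q i k : ℕ} (hp : p.Prime) (hp3 : 3 ≤ p) (hq : q.Prime)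
    (hpq : p < q) (hi : i < q) (hk : k < q) {w : List LevelFactor} {M : ℤ}
    (hw : CoeffBound (wordPoly p q w) M) :
    CoeffBound ((X ^ i - X ^ k) * wordPoly p q (.phiPQ :: w)) (p * M) := by
  refine coeffBound_cons hq.pos (fun n hn => ?_) hw
  rw [LevelFactor.poly, sub_mul, residuePart_sub hq.pos]
  exact (isRun_residuePart_X_pow_mul hp hp3 hq hpq hn hi).coeffSum_sub_le
    (isRun_residuePart_X_pow_mul hp hp3 hq hpq hn hk)

theorem CoeffBound.X_pow_sub_X_pow_mul {h : ℤ[X]} {M : ℤ} (hh : CoeffBound h M) (i k : ℕ) :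
    CoeffBound ((X ^ i - X ^ k) * h) (2 * M) := fun j => by
  rw [sub_mul, coeff_sub, coeff_X_pow_mul', coeff_X_pow_mul']
  have h1 : ∀ i, |if i ≤ j then h.coeff (j - i) else 0| ≤ M := fun i => by
    split_ifs
    · exact hh _
    · simpa using hh.nonneg
  have h2 := h1 i
  have h3 := h1 k
  rw [abs_le] at *
  omega

/-- A residue part of `(X - 1) * Φ_q(X ^ p)` is a difference of two monomials. -/
theorem exists_residuePart_X_sub_one_mul {p q n : ℕ} (hp : p.Prime) (hp3 : 3 ≤ p) (hq : q.Prime)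
    (hpq : p < q) (hn : n < q) : ∃ i < p, ∃ k < p,
      residuePart q n ((X - 1) * expand ℤ p (ones q)) = X ^ i - X ^ k := by
  have hq0 := natCast_ne_zero_of_primes hp hq hpq
  obtain ⟨i₀, h₀, e₀⟩ := exists_natCast_add_mul_eq hp hq0 n 0
  obtain ⟨i₁, h₁, e₁⟩ := exists_natCast_add_mul_eq hp hq0 n 1
  refine ⟨i₁, h₁, i₀, h₀, ?_⟩
  have hv : ∀ i, p ≤ i → (X - 1 : ℤ[X]).coeff i = 0 := fun i hi => by
    have := X_pow_sub_one_coeff_eq_zero (p := 1) i (by omega)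
    rwa [pow_one] at this
  ext j
  rw [coeff_residuePart_mul_expand_ones hp.pos hn hv, coeff_sub, coeff_X_pow, coeff_X_pow]
  split_ifs with hj h2 h3 h3
  all_goals try (exfalso; omega)
  · rw [h2] at hj
    have : (0 : ZMod p) = 1 := by rw [← e₀, ← e₁, ← h3, h2]
    have := Fact.mk hp
    simp at *
  all_goals try rw [cyclicCoeff_sub, cyclicCoeff_one, cyclicCoeff_X hp.one_lt]
  · subst h2
    have := Fact.mk hp
    rw [e₁]; simp
  · subst h3
    have := Fact.mk hp
    rw [e₀]; simp
  · rw [if_neg, if_neg]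
    · exact fun h => h3 (eq_of_natCast_add_mul_eq hp hq0 hj h₀ (h.trans e₀.symm))
    · exact fun h => h2 (eq_of_natCast_add_mul_eq hp hq0 hj h₁ (h.trans e₁.symm))
  · simp

theorem X_sub_one_coeff_eq_zero (i : ℕ) (hi : 2 ≤ i) : (X - 1 : ℤ[X]).coeff i = 0 := by
  have := X_pow_sub_one_coeff_eq_zero (p := 1) i (by omega)
  rwa [pow_one] at this

theorem coeffBound_X_sub_one_mul_none {p q : ℕ} (hq : q.Prime) (w : List LevelFactor) (M : ℤ) :
    CoeffBound ((X - 1) * wordPoly p q (.none :: w)) M ↔ CoeffBound (wordPoly p q w) M := by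
  have h1 := coeffBound_X_pow_sub_one 1
  have h2 := abs_X_pow_sub_one_coeff_zero one_pos
  rw [pow_one] at h1 h2
  rw [wordPoly_cons, LevelFactor.poly, one_mul]
  exact coeffBound_mul_expand_iff hq.pos
    (fun i hi => X_sub_one_coeff_eq_zero i (hq.two_le.trans hi)) h1 h2 _ _

theorem coeffBound_X_sub_one_mul_phiQ {p q : ℕ} (hq : q.Prime) (w : List LevelFactor) (M : ℤ) :
    CoeffBound ((X - 1) * wordPoly p q (.phiQ :: w)) M ↔
      CoeffBound ((X - 1) * wordPoly p q w) M := by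
  have : (X - 1) * wordPoly p q (.phiQ :: w) = expand ℤ q ((X - 1) * wordPoly p q w) := by
    rw [wordPoly_cons, phiQ_poly hq, map_mul, map_sub, expand_X, map_one]
    linear_combination expand ℤ q (wordPoly p q w) * ones_mul q
  rw [this, coeffBound_expand hq.pos]

theorem BothThenPhiPQ.coeffBound_X_sub_one_mul {p q : ℕ} (hp : p.Prime) (hp3 : 3 ≤ p)
    (hq : q.Prime) (hpq : p < q) {w : List LevelFactor} (hw : BothThenPhiPQ w) :
    CoeffBound ((X - 1) * wordPoly p q w)
      (p * (inverseSpread p q : ℤ) ^ (w.length - 3)) := by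
  have hm : (1 : ℤ) ≤ inverseSpread p q := by exact_mod_cast one_le_inverseSpread hp
  have hp3' : (3 : ℤ) ≤ p := by exact_mod_cast hp3
  have hpow : ∀ k, (1 : ℤ) ≤ (inverseSpread p q : ℤ) ^ k := fun k => one_le_pow₀ hm
  induction w with
  | nil => exact hw.elim
  | cons g w ih =>
    have hsub : w.length + 1 - 3 = w.length - 2 := by omega
    rw [List.length_cons, hsub]
    cases g with
    | none =>
      have hw' : BothThenPhiPQ w := hw.resolve_left (by simp)
      rw [coeffBound_X_sub_one_mul_none hq]
      exact (hw'.coeffBound_wordPoly hp hp3 hq hpq).mono (by nlinarith [hpow (w.length - 2)])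
    | phiQ =>
      have hw' : BothThenPhiPQ w := hw.resolve_left (by simp)
      rw [coeffBound_X_sub_one_mul_phiQ hq]
      refine (ih hw').mono (mul_le_mul_of_nonneg_left (pow_le_pow_right₀ hm ?_) (by omega))
      omega
    | phiPQ =>
      have hw' : BothThenPhiPQ w := hw.resolve_left (by simp)
      have := coeffBound_X_pow_sub_X_pow_mul (i := 1) (k := 0) hp hp3 hq hpq hq.one_lt hq.pos
        (hw'.coeffBound_wordPoly hp hp3 hq hpq)
      rwa [pow_one, pow_zero] at this
    | both =>
      rw [wordPoly_cons, ← mul_assoc, both_poly hp hq hpq, coeffBound_mul_expand hq.pos]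
      intro n hn
      obtain ⟨i, hi, k, hk, h⟩ := exists_residuePart_X_sub_one_mul hp hp3 hq hpq hn
      rw [h]
      rcases w with _ | ⟨g', w⟩
      · exact absurd hw.two_le_length (by simp)
      by_cases hg : g' = .phiPQ
      · subst hg
        exact coeffBound_X_pow_sub_X_pow_mul hp hp3 hq hpq (by omega) (by omega)
          (_root_.coeffBound_wordPoly hp hp3 hq hpq w)
      · have hw' : BothThenPhiPQ (g' :: w) := hw.resolve_left (by simp [hg])
        refine ((hw'.coeffBound_wordPoly hp hp3 hq hpq).X_pow_sub_X_pow_mul i k).mono ?_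
        exact mul_le_mul_of_nonneg_right (by omega) (zero_le_one.trans (hpow _))

/-! ### Reducing the starting factors `Φ_p` and `X ^ p - 1` -/

theorem coeffBound_ones_mul_none {p q : ℕ} (hp : p.Prime) (hq : q.Prime) (hpq : p < q)
    (w : List LevelFactor) (M : ℤ) :
    CoeffBound (ones p * wordPoly p q (.none :: w)) M ↔ CoeffBound (wordPoly p q w) M := by
  rw [wordPoly_cons, LevelFactor.poly, one_mul]
  exact coeffBound_mul_expand_iff hq.pos (fun i hi => by rw [coeff_ones, if_neg (by omega)])
    (coeffBound_ones p) (by simp [coeff_ones, hp.pos]) _ _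

theorem coeffBound_ones_mul_both {p q : ℕ} (hp : p.Prime) (hq : q.Prime) (hpq : p < q)
    (w : List LevelFactor) (M : ℤ) :
    CoeffBound (ones p * wordPoly p q (.both :: w)) M ↔
      CoeffBound (ones p * wordPoly p q w) M := by
  have : ones p * wordPoly p q (.both :: w) = ones q * expand ℤ q (ones p * wordPoly p q w) := by
    rw [wordPoly_cons, both_poly hp hq hpq, expand_prime_ones hp hq hpq, map_mul,
      expand_ones_prime hp hq hpq]
    ring
  rw [this]
  exact coeffBound_mul_expand_iff hq.pos (fun i hi => by rw [coeff_ones, if_neg (by omega)])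
    (coeffBound_ones q) (by simp [coeff_ones, hq.pos]) _ _

theorem coeffBound_ones_mul_phiPQ {p q : ℕ} (hp : p.Prime) (hq : q.Prime) (hpq : p < q)
    (w : List LevelFactor) (M : ℤ) :
    CoeffBound (ones p * wordPoly p q (.phiPQ :: w)) M ↔
      CoeffBound (ones p * wordPoly p q w) M := by
  have : ones p * wordPoly p q (.phiPQ :: w) = expand ℤ q (ones p * wordPoly p q w) := by
    rw [wordPoly_cons, LevelFactor.poly, map_mul, expand_ones_prime hp hq hpq]
    ring
  rw [this, coeffBound_expand hq.pos]

theorem residuePart_mul_ones_of_le {p q n : ℕ} (hpq : p ≤ q) (hn : n < q) (hpn : p - 1 ≤ n)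
    {v : ℤ[X]} (hv : ∀ i, p ≤ i → v.coeff i = 0) :
    residuePart q n (v * ones q) = C (v.eval 1) := by
  ext j
  rw [coeff_residuePart_mul_ones hpq hn hv, coeff_C, eval_one_eq_sum_range hv]
  split_ifs with hj
  · exact Finset.sum_congr rfl fun i hi => if_pos (by rw [Finset.mem_range] at hi; omega)
  · exact Finset.sum_eq_zero fun i hi => if_neg (by rw [Finset.mem_range] at hi; omega)

theorem eval_one_ones (p : ℕ) : (ones p).eval 1 = p := by
  simp [ones, eval_finsetSum]

/-- The coefficients of `Φ_p * Φ_q` along residue classes are `(k, p - k)` or `(p, 0)`, so the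
height of the product is `p` times that of the remaining factors. -/
theorem coeffBound_ones_mul_phiQ {p q : ℕ} (hp : p.Prime) (hq : q.Prime) (hpq : p < q)
    (w : List LevelFactor) (M : ℤ) :
    CoeffBound (ones p * wordPoly p q (.phiQ :: w)) M ↔
      CoeffBound (C (p : ℤ) * wordPoly p q w) M := by
  have hv : ∀ i, p ≤ i → (ones p).coeff i = 0 := fun i hi => by
    rw [coeff_ones, if_neg (by omega)]
  rw [wordPoly_cons, phiQ_poly hq, ← mul_assoc, coeffBound_mul_expand hq.pos]
  constructor
  · intro H
    have := H (p - 1) (by omega)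
    rwa [residuePart_mul_ones_of_le hpq.le (by omega) le_rfl hv, eval_one_ones] at this
  · intro H n hn i
    have hcoeff := coeff_residuePart_mul_ones hpq.le hn hv
    have hnonneg : ∀ j, 0 ≤ (residuePart q n (ones p * ones q)).coeff j := fun j => by
      rw [hcoeff]
      refine Finset.sum_nonneg fun i _ => ?_
      rw [coeff_ones]
      split_ifs <;> simp
    have hsum : coeffSum (residuePart q n (ones p * ones q)) ≤ p := by
      rw [coeffSum_eq_sum_range (N := 2) fun j hj => by
        rw [hcoeff]; exact Finset.sum_eq_zero fun k _ => if_neg (by omega)]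
      rw [Finset.sum_range_succ, Finset.sum_range_one, abs_of_nonneg (hnonneg 0),
        abs_of_nonneg (hnonneg 1), hcoeff, hcoeff, ← Finset.sum_add_distrib, ← eval_one_ones p,
        eval_one_eq_sum_range hv]
      refine Finset.sum_le_sum fun k _ => ?_
      rcases le_or_gt k n with h | h
      · simp [h, h.not_gt]
      · simp [h, h.not_ge]
    -- The bound on `p * |c|` for the coefficients `c` of the word is divided by `p`, with rounding.
    have hp0 : (0 : ℤ) < p := by exact_mod_cast hp.pos
    have hdiv : CoeffBound (wordPoly p q w) (M / p) := fun k => by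
      rw [Int.le_ediv_iff_mul_le hp0]
      have := H k
      rwa [coeff_C_mul, abs_mul, abs_of_pos hp0, mul_comm] at this
    refine (hdiv.mul hsum i).trans ?_
    exact Int.mul_ediv_self_le hp0.ne'

theorem coeffBound_X_pow_sub_one_mul_none {p q : ℕ} (hp : p.Prime) (hq : q.Prime) (hpq : p < q)
    (w : List LevelFactor) (M : ℤ) :
    CoeffBound ((X ^ p - 1) * wordPoly p q (.none :: w)) M ↔ CoeffBound (wordPoly p q w) M := by
  rw [wordPoly_cons, LevelFactor.poly, one_mul]
  exact coeffBound_mul_expand_iff hq.pos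
    (fun i hi => X_pow_sub_one_coeff_eq_zero i (by omega))
    (coeffBound_X_pow_sub_one p) (abs_X_pow_sub_one_coeff_zero hp.pos) _ _

theorem coeffBound_X_pow_sub_one_mul_phiQ {p q : ℕ} (hp : p.Prime) (hq : q.Prime) (hpq : p < q)
    (w : List LevelFactor) (M : ℤ) :
    CoeffBound ((X ^ p - 1) * wordPoly p q (.phiQ :: w)) M ↔
      CoeffBound ((X - 1) * wordPoly p q w) M := by
  have : (X ^ p - 1) * wordPoly p q (.phiQ :: w) =
      ones p * expand ℤ q ((X - 1) * wordPoly p q w) := by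
    rw [wordPoly_cons, phiQ_poly hq, map_mul, map_sub, expand_X, map_one, ← ones_mul, ← ones_mul]
    ring
  rw [this]
  exact coeffBound_mul_expand_iff hq.pos (fun i hi => by rw [coeff_ones, if_neg (by omega)])
    (coeffBound_ones p) (by simp [coeff_ones, hp.pos]) _ _

theorem X_pow_sub_one_mul_both {p q : ℕ} (hp : p.Prime) (hq : q.Prime) (hpq : p < q)
    (w : List LevelFactor) :
    (X ^ p - 1) * wordPoly p q (.both :: w) = expand ℤ q ((X ^ p - 1) * wordPoly p q w) := by
  rw [wordPoly_cons, both_poly hp hq hpq, expand_prime_ones hp hq hpq, map_mul, ← ones_mul,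
    map_mul, expand_ones_prime hp hq hpq, map_sub, expand_X, map_one, ← ones_mul]
  ring

theorem coeffBound_X_pow_sub_one_mul_phiPQ {p q : ℕ} (hp : p.Prime) (hq : q.Prime) (hpq : p < q)
    (w : List LevelFactor) (M : ℤ) :
    CoeffBound ((X ^ p - 1) * wordPoly p q (.phiPQ :: w)) M ↔
      CoeffBound (ones p * wordPoly p q w) M := by
  have : (X ^ p - 1) * wordPoly p q (.phiPQ :: w) =
      (X - 1) * expand ℤ q (ones p * wordPoly p q w) := by
    rw [wordPoly_cons, LevelFactor.poly, map_mul, expand_ones_prime hp hq hpq, ← ones_mul]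
    ring
  have h1 := coeffBound_X_pow_sub_one 1
  have h2 := abs_X_pow_sub_one_coeff_zero one_pos
  rw [pow_one] at h1 h2
  rw [this]
  exact coeffBound_mul_expand_iff hq.pos
    (fun i hi => X_sub_one_coeff_eq_zero i (hq.two_le.trans hi)) h1 h2 _ _

/-! ### The dichotomy: transfer from `q` to `r`, or a small height -/

/-- Every coefficient bound for `s * wordPoly p r w` also holds for `q`, or else the height of
`s * wordPoly p q w` is at most `p * m ^ (length - 3)` with `m = inverseSpread p q`. -/
def TransferOrSmall (p q r : ℕ) (s : ℤ[X]) (w : List LevelFactor) : Prop :=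
  (∀ M, CoeffBound (s * wordPoly p r w) M → CoeffBound (s * wordPoly p q w) M) ∨
    (2 ≤ w.length ∧
      CoeffBound (s * wordPoly p q w) (p * (inverseSpread p q : ℤ) ^ (w.length - 3)))

/-- If the starting factor `s` with the word `g :: w` has the same height as `s'` with `w`, both for
`q` and for `r`, then the dichotomy passes from the shorter word to the longer. -/
theorem TransferOrSmall.cons {p q r : ℕ} (hp : p.Prime) {s s' : ℤ[X]} {g : LevelFactor}
    {w : List LevelFactor} (h : TransferOrSmall p q r s' w)
    (hq : ∀ M, CoeffBound (s * wordPoly p q (g :: w)) M ↔ CoeffBound (s' * wordPoly p q w) M)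
    (hr : ∀ M, CoeffBound (s * wordPoly p r (g :: w)) M ↔ CoeffBound (s' * wordPoly p r w) M) :
    TransferOrSmall p q r s (g :: w) := by
  have hm : (1 : ℤ) ≤ inverseSpread p q := by exact_mod_cast one_le_inverseSpread hp
  rcases h with h | ⟨hlen, h⟩
  · left
    intro M
    rw [hq, hr]
    exact h M
  · right
    refine ⟨by simp; omega, ?_⟩
    rw [hq]
    refine h.mono (mul_le_mul_of_nonneg_left (pow_le_pow_right₀ hm ?_) (by omega))
    simp
    omega

theorem transferOrSmall_one {p q r : ℕ} (hp : p.Prime) (hp3 : 3 ≤ p) (hq : q.Prime)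
    (hr : r.Prime) (hpq : p < q) (hpr : p < r)
    (hqr : (q : ZMod p) = r ∨ (q : ZMod p) = -r) (w : List LevelFactor) :
    TransferOrSmall p q r 1 w := by
  by_cases hw : BothThenPhiPQ w
  · right
    have hlen := hw.two_le_length
    have hm : (1 : ℤ) ≤ inverseSpread p q := by exact_mod_cast one_le_inverseSpread hp
    have hmp : (inverseSpread p q : ℤ) ≤ p := by exact_mod_cast inverseSpread_le hp
    refine ⟨hlen, ?_⟩
    rw [one_mul]
    refine (hw.coeffBound_wordPoly hp hp3 hq hpq).mono ?_
    have hpow : (1 : ℤ) ≤ (inverseSpread p q : ℤ) ^ (w.length - 3) := one_le_pow₀ hm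
    rcases Nat.eq_or_lt_of_le hlen with h | h
    · rw [← h]
      simp
      omega
    · rw [show w.length - 2 = w.length - 3 + 1 by omega, pow_succ']
      exact mul_le_mul_of_nonneg_right hmp (by omega)
  · left
    intro M
    refine coeffBound_transfer hp hp3 hq hr hpq hpr hqr hw (fun i hi => ?_) (fun _ i hi => ?_) <;>
      rw [coeff_one, if_neg (by omega)]

theorem transferOrSmall_X_sub_one {p q r : ℕ} (hp : p.Prime) (hp3 : 3 ≤ p) (hq : q.Prime)
    (hr : r.Prime) (hpq : p < q) (hpr : p < r)
    (hqr : (q : ZMod p) = r ∨ (q : ZMod p) = -r) (w : List LevelFactor) :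
    TransferOrSmall p q r (X - 1) w := by
  by_cases hw : BothThenPhiPQ w
  · exact Or.inr ⟨hw.two_le_length, hw.coeffBound_X_sub_one_mul hp hp3 hq hpq⟩
  · left
    intro M
    exact coeffBound_transfer hp hp3 hq hr hpq hpr hqr hw
      (fun i hi => X_sub_one_coeff_eq_zero i (by omega))
      (fun _ i hi => X_sub_one_coeff_eq_zero i (by omega))

theorem transferOrSmall_ones {p q r : ℕ} (hp : p.Prime) (hp3 : 3 ≤ p) (hq : q.Prime)
    (hr : r.Prime) (hpq : p < q) (hpr : p < r)
    (hqr : (q : ZMod p) = r ∨ (q : ZMod p) = -r) (w : List LevelFactor) :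
    TransferOrSmall p q r (ones p) w := by
  induction w with
  | nil => exact Or.inl fun _ h => h
  | cons g w ih =>
    cases g with
    | none =>
      refine (transferOrSmall_one hp hp3 hq hr hpq hpr hqr w).cons hp (fun M => ?_) (fun M => ?_)
      · rw [one_mul]; exact coeffBound_ones_mul_none hp hq hpq w M
      · rw [one_mul]; exact coeffBound_ones_mul_none hp hr hpr w M
    | phiQ =>
      by_cases hw : BothThenPhiPQ w
      · right
        have hlen := hw.two_le_length
        refine ⟨by simp; omega, ?_⟩
        rw [coeffBound_ones_mul_phiQ hp hq hpq, List.length_cons,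
          show w.length + 1 - 3 = w.length - 2 by omega]
        intro i
        rw [coeff_C_mul, abs_mul, Nat.abs_cast]
        exact mul_le_mul_of_nonneg_left (hw.coeffBound_wordPoly hp hp3 hq hpq i) (by omega)
      · left
        intro M
        rw [coeffBound_ones_mul_phiQ hp hq hpq, coeffBound_ones_mul_phiQ hp hr hpr]
        refine coeffBound_transfer hp hp3 hq hr hpq hpr hqr hw (fun i hi => ?_)
          (fun _ i hi => ?_) <;> rw [coeff_C, if_neg (by omega)]
    | both =>
      exact ih.cons hp (coeffBound_ones_mul_both hp hq hpq w)
        (coeffBound_ones_mul_both hp hr hpr w)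
    | phiPQ =>
      exact ih.cons hp (coeffBound_ones_mul_phiPQ hp hq hpq w)
        (coeffBound_ones_mul_phiPQ hp hr hpr w)

theorem transferOrSmall_X_pow_sub_one {p q r : ℕ} (hp : p.Prime) (hp3 : 3 ≤ p) (hq : q.Prime)
    (hr : r.Prime) (hpq : p < q) (hpr : p < r)
    (hqr : (q : ZMod p) = r ∨ (q : ZMod p) = -r) (w : List LevelFactor) :
    TransferOrSmall p q r (X ^ p - 1) w := by
  induction w with
  | nil => exact Or.inl fun _ h => h
  | cons g w ih =>
    cases g with
    | none =>
      refine (transferOrSmall_one hp hp3 hq hr hpq hpr hqr w).cons hp (fun M => ?_) (fun M => ?_)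
      · rw [one_mul]; exact coeffBound_X_pow_sub_one_mul_none hp hq hpq w M
      · rw [one_mul]; exact coeffBound_X_pow_sub_one_mul_none hp hr hpr w M
    | phiQ =>
      exact (transferOrSmall_X_sub_one hp hp3 hq hr hpq hpr hqr w).cons hp
        (coeffBound_X_pow_sub_one_mul_phiQ hp hq hpq w)
        (coeffBound_X_pow_sub_one_mul_phiQ hp hr hpr w)
    | both =>
      refine ih.cons hp (fun M => ?_) (fun M => ?_)
      · rw [X_pow_sub_one_mul_both hp hq hpq, coeffBound_expand hq.pos]
      · rw [X_pow_sub_one_mul_both hp hr hpr, coeffBound_expand hr.pos]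
    | phiPQ =>
      exact (transferOrSmall_ones hp hp3 hq hr hpq hpr hqr w).cons hp
        (coeffBound_X_pow_sub_one_mul_phiPQ hp hq hpq w)
        (coeffBound_X_pow_sub_one_mul_phiPQ hp hr hpr w)

/-! ### Divisors of large height -/

theorem abs_le_of_coeffBound_C_mul {p q : ℕ} (hq : q.Prime) {w : List LevelFactor} {c M : ℤ}
    (h : CoeffBound (C c * wordPoly p q w) M) : |c| ≤ M := by
  have := h (wordPoly p q w).natDegree
  rwa [coeff_C_mul, (wordPoly_monic hq w).coeff_natDegree, mul_one] at this

theorem exists_eval_one_residuePart_cyclotomic {p q : ℕ} (hp : p.Prime) (hp3 : 3 ≤ p)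
    (hq : q.Prime) (hpq : p < q) : ∃ n < q,
      |(residuePart q n (cyclotomic (p * q) ℤ)).eval 1| = inverseSpread p q := by
  have := Fact.mk hp
  have hq0 := natCast_ne_zero_of_primes hp hq hpq
  have ha := inverseResidue_lt (q := q) hp
  have hqa : (q : ZMod p) * (inverseResidue p q : ZMod p) = 1 := by
    simp [inverseResidue, mul_inv_cancel₀ hq0]
  have ha0 : 0 < inverseResidue p q := Nat.pos_of_ne_zero fun h => by
    rw [h] at hqa
    simp at hqa
  -- The run of `1`s starts at `0` in the class of `0`; the run of `-1`s does in the class of `1`.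
  rcases le_total (p - inverseResidue p q) (inverseResidue p q) with h | h
  · refine ⟨0, hq.pos, ?_⟩
    rw [eval_one_residuePart_cyclotomic hp hp3 hq hpq hq.pos hp.pos ha (by simp)
      (by simpa using hqa), inverseSpread, max_eq_left h]
    simp
  · refine ⟨1, hq.one_lt, ?_⟩
    rw [eval_one_residuePart_cyclotomic hp hp3 hq hpq hq.one_lt (i₀ := p - inverseResidue p q)
      (by omega) hp.pos ?_ (by simp), inverseSpread, max_eq_right h]
    · simp
    · rw [Nat.cast_sub ha.le, ZMod.natCast_self]
      push_cast
      linear_combination -hqa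

theorem exists_coeffBound_C_mul {p q : ℕ} (hp : p.Prime) (hp3 : 3 ≤ p) (hq : q.Prime)
    (hpq : p < q) {w : List LevelFactor} {c M : ℤ}
    (h : CoeffBound (C c * wordPoly p q (.phiPQ :: .phiQ :: w)) M) :
    ∃ c', |c'| = |c| * inverseSpread p q ∧ CoeffBound (C c' * wordPoly p q w) M := by
  obtain ⟨n, hn, he⟩ := exists_eval_one_residuePart_cyclotomic hp hp3 hq hpq
  rw [wordPoly_cons, ← mul_assoc, coeffBound_mul_expand hq.pos] at h
  have h1 := h n hn
  have hrp : residuePart q n (C c * cyclotomic (p * q) ℤ) =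
      C c * residuePart q n (cyclotomic (p * q) ℤ) := by
    ext j
    simp only [residuePart_coeff hq.pos, coeff_C_mul]
  rw [LevelFactor.poly, hrp, wordPoly_cons, phiQ_poly hq, ← mul_assoc,
    coeffBound_mul_expand hq.pos] at h1
  have h2 := h1 (p - 1) (by omega)
  rw [residuePart_mul_ones_of_le hpq.le (by omega) le_rfl, eval_mul, eval_C] at h2
  · exact ⟨_, by rw [abs_mul, he], h2⟩
  · intro i hi
    rw [coeff_C_mul, (isRun_residuePart_cyclotomic hp hp3 hq hpq hn).1 i hi, mul_zero]

/-- For `2 ≤ b ≤ 5` some divisor has height at least `p * m ^ (b - 3)`, where `m` is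
`inverseSpread p q`. The words are `Φ_q` followed by pairs `Φ_(pq), Φ_q`, padded with `1`. -/
theorem exists_word_large {p q b : ℕ} (hp : p.Prime) (hp3 : 3 ≤ p) (hq : q.Prime)
    (hpq : p < q) (hb : 2 ≤ b) (hb5 : b ≤ 5) : ∃ w : List LevelFactor, w.length = b ∧
      ∀ M, CoeffBound (ones p * wordPoly p q w) M →
        (p : ℤ) * (inverseSpread p q : ℤ) ^ (b - 3) ≤ M := by
  have h0 : ∀ w M, CoeffBound (ones p * wordPoly p q (.phiQ :: w)) M → (p : ℤ) ≤ M := by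
    intro w M h
    rw [coeffBound_ones_mul_phiQ hp hq hpq] at h
    simpa using abs_le_of_coeffBound_C_mul hq h
  interval_cases b
  · exact ⟨[.phiQ, .none], rfl, fun M h => by simpa using h0 _ _ h⟩
  · exact ⟨[.phiQ, .none, .none], rfl, fun M h => by simpa using h0 _ _ h⟩
  · refine ⟨[.phiQ, .phiPQ, .phiQ, .none], rfl, fun M h => ?_⟩
    rw [coeffBound_ones_mul_phiQ hp hq hpq] at h
    obtain ⟨c, hc, h⟩ := exists_coeffBound_C_mul hp hp3 hq hpq h
    have := abs_le_of_coeffBound_C_mul hq h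
    rw [hc, Nat.abs_cast] at this
    simpa using this
  · refine ⟨[.phiQ, .phiPQ, .phiQ, .phiPQ, .phiQ], rfl, fun M h => ?_⟩
    rw [coeffBound_ones_mul_phiQ hp hq hpq] at h
    obtain ⟨c, hc, h⟩ := exists_coeffBound_C_mul hp hp3 hq hpq h
    obtain ⟨c', hc', h⟩ := exists_coeffBound_C_mul hp hp3 hq hpq h
    have := abs_le_of_coeffBound_C_mul hq h
    rw [hc', hc, Nat.abs_cast] at this
    calc (p : ℤ) * (inverseSpread p q : ℤ) ^ 2
        = p * inverseSpread p q * inverseSpread p q := by ring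
      _ ≤ M := this

/-! ### Divisors of `X ^ (p * q ^ b) - 1` -/

/-- The word all of whose factors are `Φ_q * Φ_(pq)`. -/
def fullWord (b : ℕ) : List LevelFactor := List.replicate b .both

theorem X_pow_sub_one_mul_fullWord {p q : ℕ} (hp : p.Prime) (hq : q.Prime) (hpq : p < q)
    (b : ℕ) : (X ^ p - 1) * wordPoly p q (fullWord b) = X ^ (p * q ^ b) - 1 := by
  induction b with
  | zero => simp [fullWord, wordPoly]
  | succ b ih =>
    rw [fullWord, List.replicate_succ, ← fullWord, X_pow_sub_one_mul_both hp hq hpq, ih, map_sub,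
      map_pow, expand_X, map_one, ← pow_mul, pow_succ]
    ring

theorem wordPoly_dvd_fullWord (p q : ℕ) (w : List LevelFactor) :
    wordPoly p q w ∣ wordPoly p q (fullWord w.length) := by
  induction w with
  | nil => exact dvd_rfl
  | cons g w ih =>
    rw [List.length_cons, fullWord, List.replicate_succ, ← fullWord, wordPoly_cons, wordPoly_cons]
    obtain ⟨c, hc⟩ := ih
    refine mul_dvd_mul ?_ ⟨expand ℤ q c, by rw [hc, map_mul]⟩
    cases g
    · exact one_dvd _
    · exact dvd_mul_right _ _
    · exact dvd_rfl
    · exact dvd_mul_left _ _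

theorem mul_wordPoly_dvd {p q : ℕ} (hp : p.Prime) (hq : q.Prime) (hpq : p < q) {s : ℤ[X]}
    (hs : s ∣ X ^ p - 1) (w : List LevelFactor) :
    s * wordPoly p q w ∣ X ^ (p * q ^ w.length) - 1 := by
  rw [← X_pow_sub_one_mul_fullWord hp hq hpq]
  exact mul_dvd_mul hs (wordPoly_dvd_fullWord p q w)

theorem expand_pow_cyclotomic {q n : ℕ} (hq : q.Prime) (hn : q ∣ n) (k : ℕ) :
    expand ℤ (q ^ k) (cyclotomic n ℤ) = cyclotomic (n * q ^ k) ℤ := by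
  induction k with
  | zero => simp
  | succ k ih =>
    rw [pow_succ', expand_mul, ih,
      cyclotomic_expand_eq_cyclotomic hq (dvd_mul_of_dvd_left hn _)]
    ring_nf

theorem associated_one_or_of_dvd_irreducible {f g : ℤ[X]} (hg : Irreducible g) (h : f ∣ g) :
    Associated f 1 ∨ Associated f g := by
  rcases hg.dvd_iff.mp h with h | h
  · exact Or.inl (associated_one_iff_isUnit.mpr h)
  · exact Or.inr h.symm

theorem exists_levelFactor_of_dvd {p q : ℕ} (hp : p.Prime) (hq : q.Prime) (k : ℕ) {f : ℤ[X]}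
    (hf : f ∣ expand ℤ (q ^ k) (LevelFactor.both.poly p q)) :
    ∃ g : LevelFactor, Associated f (expand ℤ (q ^ k) (g.poly p q)) := by
  rw [LevelFactor.poly, map_mul] at hf
  obtain ⟨f₁, f₂, h₁, h₂, rfl⟩ := exists_dvd_and_dvd_of_dvd_mul hf
  have i₁ : Irreducible (expand ℤ (q ^ k) (cyclotomic q ℤ)) := by
    rw [expand_pow_cyclotomic hq dvd_rfl]
    exact cyclotomic.irreducible (Nat.mul_pos hq.pos (pow_pos hq.pos k))
  have i₂ : Irreducible (expand ℤ (q ^ k) (cyclotomic (p * q) ℤ)) := by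
    rw [expand_pow_cyclotomic hq (dvd_mul_left q p)]
    exact cyclotomic.irreducible (Nat.mul_pos (Nat.mul_pos hp.pos hq.pos) (pow_pos hq.pos k))
  rcases associated_one_or_of_dvd_irreducible i₁ h₁ with a₁ | a₁ <;>
    rcases associated_one_or_of_dvd_irreducible i₂ h₂ with a₂ | a₂
  · exact ⟨.none, by simpa [LevelFactor.poly] using a₁.mul_mul a₂⟩
  · exact ⟨.phiPQ, by simpa [LevelFactor.poly] using a₁.mul_mul a₂⟩
  · exact ⟨.phiQ, by simpa [LevelFactor.poly] using a₁.mul_mul a₂⟩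
  · exact ⟨.both, by simpa [LevelFactor.poly] using a₁.mul_mul a₂⟩

theorem exists_word_of_dvd {p q : ℕ} (hp : p.Prime) (hq : q.Prime) (b k : ℕ) {f : ℤ[X]}
    (hf : f ∣ expand ℤ (q ^ k) (wordPoly p q (fullWord b))) :
    ∃ w : List LevelFactor, w.length = b ∧
      Associated f (expand ℤ (q ^ k) (wordPoly p q w)) := by
  induction b generalizing k f with
  | zero =>
    refine ⟨[], rfl, ?_⟩
    simpa [fullWord, wordPoly, associated_one_iff_isUnit, isUnit_iff_dvd_one] using hf
  | succ b ih =>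
    rw [fullWord, List.replicate_succ, ← fullWord, wordPoly_cons, map_mul, ← expand_mul,
      ← pow_succ] at hf
    obtain ⟨f₁, f₂, h₁, h₂, rfl⟩ := exists_dvd_and_dvd_of_dvd_mul hf
    obtain ⟨g, hg⟩ := exists_levelFactor_of_dvd hp hq k h₁
    obtain ⟨w, hw, hw'⟩ := ih (k + 1) h₂
    refine ⟨g :: w, by simp [hw], ?_⟩
    rw [wordPoly_cons, map_mul, ← expand_mul, ← pow_succ]
    exact hg.mul_mul hw'

theorem exists_start_of_dvd {p : ℕ} (hp : p.Prime) {f : ℤ[X]} (hf : f ∣ X ^ p - 1) :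
    ∃ s ∈ ({1, X - 1, ones p, X ^ p - 1} : Set ℤ[X]), Associated f s := by
  rw [← ones_mul] at hf
  obtain ⟨f₁, f₂, h₁, h₂, rfl⟩ := exists_dvd_and_dvd_of_dvd_mul hf
  have i₁ : Irreducible (ones p) := by
    rw [← cyclotomic_eq_ones hp]
    exact cyclotomic.irreducible hp.pos
  have i₂ : Irreducible (X - 1 : ℤ[X]) := by
    rw [← C_1]
    exact irreducible_X_sub_C 1
  rw [← ones_mul]
  rcases associated_one_or_of_dvd_irreducible i₁ h₁ with a₁ | a₁ <;>
    rcases associated_one_or_of_dvd_irreducible i₂ h₂ with a₂ | a₂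
  · exact ⟨1, by simp, by simpa using a₁.mul_mul a₂⟩
  · exact ⟨X - 1, by simp, by simpa using a₁.mul_mul a₂⟩
  · exact ⟨ones p, by simp, by simpa using a₁.mul_mul a₂⟩
  · exact ⟨ones p * (X - 1), by simp, a₁.mul_mul a₂⟩

theorem exists_start_word_of_dvd {p q b : ℕ} (hp : p.Prime) (hq : q.Prime) (hpq : p < q)
    {f : ℤ[X]} (hf : f ∣ X ^ (p * q ^ b) - 1) :
    ∃ s ∈ ({1, X - 1, ones p, X ^ p - 1} : Set ℤ[X]), ∃ w : List LevelFactor, w.length = b ∧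
      Associated f (s * wordPoly p q w) := by
  rw [← X_pow_sub_one_mul_fullWord hp hq hpq] at hf
  obtain ⟨f₁, f₂, h₁, h₂, rfl⟩ := exists_dvd_and_dvd_of_dvd_mul hf
  obtain ⟨s, hs, hs'⟩ := exists_start_of_dvd hp h₁
  obtain ⟨w, hw, hw'⟩ := exists_word_of_dvd hp hq b 0 (f := f₂) (by simpa using h₂)
  refine ⟨s, hs, w, hw, hs'.mul_mul ?_⟩
  simpa using hw'

theorem start_dvd {p : ℕ} {s : ℤ[X]}
    (hs : s ∈ ({1, X - 1, ones p, X ^ p - 1} : Set ℤ[X])) : s ∣ X ^ p - 1 := by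
  rw [← ones_mul] at hs ⊢
  rcases hs with rfl | rfl | rfl | rfl
  · exact one_dvd _
  · exact dvd_mul_left _ _
  · exact dvd_mul_right _ _
  · exact dvd_rfl

theorem CoeffBound.of_associated {f g : ℤ[X]} {M : ℤ} (h : Associated f g)
    (hg : CoeffBound g M) : CoeffBound f M := by
  obtain ⟨u, rfl⟩ := h.symm
  obtain ⟨c, hc, hu⟩ := Polynomial.isUnit_iff.mp u.isUnit
  rw [← hu, mul_comm]
  exact hg.C_mul (Int.isUnit_iff_abs_eq.mp hc).le

theorem coeffBound_maxDivisorHeight {n : ℕ} (hn : 0 < n) {f : ℤ[X]} (hf : f ∣ X ^ n - 1) :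
    CoeffBound f (maxDivisorHeight n) :=
  coeffBound_iff_polyHeight.mpr ((isGreatest_maxDivisorHeight hn).2 ⟨f, hf, rfl⟩)

theorem maxDivisorHeight_le {n : ℕ} (hn : 0 < n) {M : ℕ}
    (h : ∀ f : ℤ[X], f ∣ X ^ n - 1 → CoeffBound f M) : maxDivisorHeight n ≤ M := by
  obtain ⟨f, hf, hM⟩ := (isGreatest_maxDivisorHeight hn).1
  rw [← hM]
  exact coeffBound_iff_polyHeight.mp (h f hf)

/-! ### Dependence of `B(p * q ^ b)` on `± q` modulo `p` -/

theorem maxDivisorHeight_le_of_eq_or_eq_neg {p q r b : ℕ} (hp : p.Prime) (hp3 : 3 ≤ p)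
    (hq : q.Prime) (hr : r.Prime) (hpq : p < q) (hpr : p < r) (hb : b ≤ 5)
    (hqr : (q : ZMod p) = r ∨ (q : ZMod p) = -r) :
    maxDivisorHeight (p * q ^ b) ≤ maxDivisorHeight (p * r ^ b) := by
  have hnq : 0 < p * q ^ b := Nat.mul_pos hp.pos (pow_pos hq.pos b)
  have hnr : 0 < p * r ^ b := Nat.mul_pos hp.pos (pow_pos hr.pos b)
  refine maxDivisorHeight_le hnq fun f hf => ?_
  obtain ⟨s, hs, w, hw, hassoc⟩ := exists_start_word_of_dvd hp hq hpq hf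
  refine CoeffBound.of_associated hassoc ?_
  have hts : TransferOrSmall p q r s w := by
    rcases hs with rfl | rfl | rfl | rfl
    · exact transferOrSmall_one hp hp3 hq hr hpq hpr hqr w
    · exact transferOrSmall_X_sub_one hp hp3 hq hr hpq hpr hqr w
    · exact transferOrSmall_ones hp hp3 hq hr hpq hpr hqr w
    · exact transferOrSmall_X_pow_sub_one hp hp3 hq hr hpq hpr hqr w
  have hword : ∀ {s : ℤ[X]}, s ∈ ({1, X - 1, ones p, X ^ p - 1} : Set ℤ[X]) →
      ∀ w : List LevelFactor, w.length = b →
        CoeffBound (s * wordPoly p r w) (maxDivisorHeight (p * r ^ b)) := fun hs w hw =>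
    coeffBound_maxDivisorHeight hnr (hw ▸ mul_wordPoly_dvd hp hr hpr (start_dvd hs) w)
  rcases hts with h | ⟨hlen, h⟩
  · exact h _ (hword hs w hw)
  · obtain ⟨w', hw', hlarge⟩ := exists_word_large hp hp3 hr hpr (hw ▸ hlen) hb
    rw [hw, inverseSpread_eq hp hq hpq hqr] at h
    exact h.mono (hlarge _ (hword (by simp) w' hw'))

theorem maxDivisorHeight_eq_of_eq_or_eq_neg {p q r b : ℕ} (hp : p.Prime) (hp3 : 3 ≤ p)
    (hq : q.Prime) (hr : r.Prime) (hpq : p < q) (hpr : p < r) (hb : b ≤ 5)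
    (hqr : (q : ZMod p) = r ∨ (q : ZMod p) = -r) :
    maxDivisorHeight (p * q ^ b) = maxDivisorHeight (p * r ^ b) := by
  refine le_antisymm (maxDivisorHeight_le_of_eq_or_eq_neg hp hp3 hq hr hpq hpr hb hqr)
    (maxDivisorHeight_le_of_eq_or_eq_neg hp hp3 hr hq hpr hpq hb ?_)
  rcases hqr with h | h
  · exact Or.inl h.symm
  · exact Or.inr (by rw [h, neg_neg])

theorem three_le_of_odd_prime {p : ℕ} (hp : p.Prime) (hodd : Odd p) : 3 ≤ p := by
  have := hp.two_le
  obtain ⟨k, rfl⟩ := hodd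
  omega

theorem theorem1p8 :
    (∀ p q r b : ℕ, p.Prime → q.Prime → r.Prime → Odd p → p < q → q < r → b ≤ 5 →
      ((q : ℤ) ≡ (r : ℤ) [ZMOD (p : ℤ)] ∨ (q : ℤ) ≡ -(r : ℤ) [ZMOD (p : ℤ)]) →
      maxDivisorHeight (p * q ^ b) = maxDivisorHeight (p * r ^ b)) ∧
    (∀ p b : ℕ, p.Prime → Odd p → b ≤ 5 →
      ∃ F : ZMod p → ℕ, (∀ a : ZMod p, F (-a) = F a) ∧
        ∀ q : ℕ, q.Prime → p < q → maxDivisorHeight (p * q ^ b) = F (q : ZMod p)) := by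
  constructor
  · intro p q r b hp hq hr hodd hpq hqr hb h
    refine maxDivisorHeight_eq_of_eq_or_eq_neg hp (three_le_of_odd_prime hp hodd) hq hr hpq
      (hpq.trans hqr) hb ?_
    simpa [← ZMod.intCast_eq_intCast_iff] using h
  · intro p b hp hodd hb
    -- The set of values at primes in the classes `± a` has at most one element.
    refine ⟨fun a => sSup {h | ∃ r : ℕ, r.Prime ∧ p < r ∧ ((r : ZMod p) = a ∨ (r : ZMod p) = -a) ∧
      maxDivisorHeight (p * r ^ b) = h}, fun a => ?_, fun q hq hpq => ?_⟩
    · simp only [neg_neg]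
      congr 1
      ext h
      simp only [or_comm]
    · have : {h | ∃ r : ℕ, r.Prime ∧ p < r ∧ ((r : ZMod p) = q ∨ (r : ZMod p) = -q) ∧
          maxDivisorHeight (p * r ^ b) = h} = {maxDivisorHeight (p * q ^ b)} := by
        ext h
        rw [Set.mem_singleton_iff]
        constructor
        · rintro ⟨r, hr, hpr, hrq, rfl⟩
          exact maxDivisorHeight_eq_of_eq_or_eq_neg hp (three_le_of_odd_prime hp hodd) hr hq hpr
            hpq hb hrq
        · rintro rfl
          exact ⟨q, hq, hpq, Or.inl rfl, rfl⟩
      simp only [this, csSup_singleton]
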